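/- Let $\mu\in\mathbb{R}$ and let $V:\mathbb{R}^3\to[0,\infty)$ be spherically symmetric with $V\in L^\infty(\mathbb{R}^3)$ and $|r|V\in L^\infty(\mathbb{R}^3)$. Let $L^2_{\rm symm}(\mathbb{R}^3)$ be the space of all $\alpha\in L^2(\mathbb{R}^3)$ with $\alpha(-r)=\alpha(r)$. For $0<\beta<\infty$ let $\chi_\beta(E)=E^{-1}\tanh(\beta E/2)$ (with $\chi_\beta(0)=\beta/2$), let $\chi_\infty(E)=|E|^{-1}$, and let $p_r=-i\nabla_r$. Assume that $\sup\operatorname{spec} V^{1/2}\chi_\infty(p_r^2-\mu)V^{1/2}>1$, where the operator acts in $L^2_{\rm symm}(\mathbb{R}^3)$ and the supremum of the spectrum is understood as the supremum in $[0,\infty]$ of the quadratic form over normalized functions. Let $\beta_c\in(0,\infty)$ be the critical inverse temperature, that is, the unique number such that $\sup\operatorname{spec} V^{1/2}\chi_\beta(p_r^2-\mu)V^{1/2}\le 1$ for $\beta\le\beta_c$ and $>1$ for $\beta>\beta_c$. Assume that $1$ is a simple eigenvalue of $V^{1/2}\chi_{\beta_c}(p_r^2-\mu)V^{1/2}$ in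 $L^2_{\rm symm}(\mathbb{R}^3)$, and let $\phi_*$ be a corresponding eigenfunction with $\|\phi_*\|=1$ (it is unique up to a phase and may be chosen real-valued). For $B>0$ let $\Pi_X=-i\nabla_X+\mathbf{B}\wedge X$ with $\mathbf{B}=Be_3$, let $\Pi_X^2$ denote the Friedrichs extension in $L^2(\mathbb{R}^3)$ of the corresponding differential expression on $C_c^\infty(\mathbb{R}^3)$, and let $$ R=\int_{\mathbb{R}^3}|\phi_*(r)|^2\cos(r\cdot\Pi_X)\,dr , $$ a bounded operator on $L^2(\mathbb{R}^3)$. Then for every $B_0>0$ there are constants $c>0$ and $E_0>0$ such that for all $0<B\le B_0$, in the sense of operators on $L^2(\mathbb{R}^3)$, $$ 1-R^2\ \ge\ c\,\frac{\Pi_X^2}{E_0+\Pi_X^2}. $$ -/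

import Mathlib

open MeasureTheory Filter Topology
open scoped ENNReal ContDiff FourierTransform

noncomputable section

/-- Three-dimensional Euclidean space `ℝ³`. -/
abbrev E3 : Type := EuclideanSpace ℝ (Fin 3)

/-- The complex Hilbert space `L²(ℝ³)`. -/
abbrev L2 : Type := Lp (α := E3) ℂ 2 volume

/-! ### Multiplication operators, translations, reflection -/

/-- Multiplication by an essentially bounded function `g`, as a bounded operator on `L²(ℝ³)`. -/
def mulOp (g : E3 → ℂ) (hg : MemLp g ⊤ volume) : L2 →L[ℂ] L2 :=
  (ContinuousLinearMap.mul ℂ ℂ).holderL volume ⊤ 2 2 (hg.toLp g)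

lemma mulOp_coeFn (g : E3 → ℂ) (hg : MemLp g ⊤ volume) (f : L2) :
    mulOp g hg f =ᵐ[volume] fun x => g x * f x := by
  have h1 := (ContinuousLinearMap.mul ℂ ℂ).coeFn_holder (r := 2) (hg.toLp g) f
  filter_upwards [h1, hg.coeFn_toLp] with x hx hy
  simp only [mulOp, ContinuousLinearMap.holderL_apply_apply]
  rw [hx, hy]
  rfl

/-- The translation `(τ_r ψ)(X) = ψ(X + r)` on `L²(ℝ³)`. -/
def translation (r : E3) : L2 →L[ℂ] L2 :=
  (Lp.compMeasurePreservingₗᵢ ℂ (fun x : E3 => x + r)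
    (measurePreserving_add_right volume r)).toContinuousLinearMap

/-- The reflection `ψ ↦ ψ(- ·)` on `L²(ℝ³)`. -/
def reflection : L2 →L[ℂ] L2 :=
  (Lp.compMeasurePreservingₗᵢ ℂ (fun x : E3 => -x)
    (Measure.measurePreserving_neg volume)).toContinuousLinearMap

/-- The subspace `L²_symm(ℝ³)` of all `α ∈ L²(ℝ³)` with `α(-r) = α(r)`. -/
def L2symm : Submodule ℂ L2 := LinearMap.eqLocus reflection.toLinearMap LinearMap.id

/-! ### The interaction potential and the one-body operator -/

/-- A non-negative, spherically symmetric potential `V` such that `V` and `|r| V` are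
essentially bounded. -/
structure InteractionPotential where
  V : E3 → ℝ
  nonneg : ∀ x, 0 ≤ V x
  radial : ∀ x y : E3, ‖x‖ = ‖y‖ → V x = V y
  memLp_top : MemLp V ⊤ volume
  memLp_top_norm_mul : MemLp (fun r : E3 => ‖r‖ * V r) ⊤ volume

lemma InteractionPotential.memLp_sqrt (W : InteractionPotential) :
    MemLp (fun x => ((√(W.V x) : ℝ) : ℂ)) ⊤ volume := by
  have hm : AEStronglyMeasurable (fun x => ((√(W.V x) : ℝ) : ℂ)) volume :=
    (Complex.continuous_ofReal.comp Real.continuous_sqrt).comp_aestronglyMeasurable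
      W.memLp_top.aestronglyMeasurable
  have hb := ae_le_eLpNormEssSup (f := W.V) (μ := (volume : Measure E3))
  have hfin : eLpNormEssSup W.V (volume : Measure E3) < ⊤ := by
    simpa using W.memLp_top.eLpNorm_lt_top
  refine memLp_top_of_bound hm (√(eLpNormEssSup W.V (volume : Measure E3)).toReal) ?_
  filter_upwards [hb] with x hx
  have h2 : ‖W.V x‖ ≤ (eLpNormEssSup W.V (volume : Measure E3)).toReal := by
    have := ENNReal.toReal_mono hfin.ne hx
    simpa using this
  rw [Complex.norm_real, Real.norm_of_nonneg (Real.sqrt_nonneg _)]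
  exact Real.sqrt_le_sqrt ((le_abs_self _).trans h2)

/-- Multiplication by `V^{1/2}` on `L²(ℝ³)`. -/
def InteractionPotential.sqrtOp (W : InteractionPotential) : L2 →L[ℂ] L2 :=
  mulOp _ W.memLp_sqrt

/-- `χ_β(E) = tanh(βE/2)/E`, continuously extended by `β/2` at `E = 0`. -/
def chi (β E : ℝ) : ℝ := if E = 0 then β / 2 else Real.tanh (β * E / 2) / E

/-- The symbol `p² - μ` of the operator `-Δ - μ`; since the Fourier transform is normalized with
`e^{-2πi x·ξ}`, the momentum is `p = 2πξ`. -/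
def kineticSymbol (μ : ℝ) (ξ : E3) : ℝ := (2 * Real.pi * ‖ξ‖) ^ 2 - μ

lemma abs_tanh_le (x : ℝ) : |Real.tanh x| ≤ |x| := by
  have hd : ∀ y : ℝ, HasDerivAt Real.tanh (1 / Real.cosh y ^ 2) y := by
    intro y
    have h := (Real.hasDerivAt_sinh y).div (Real.hasDerivAt_cosh y) (Real.cosh_pos y).ne'
    have e : Real.tanh = Real.sinh / Real.cosh := by
      funext z; exact Real.tanh_eq_sinh_div_cosh z
    rw [e]
    refine h.congr_deriv ?_
    congr 1
    have := Real.cosh_sq y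
    linarith
  have h := convex_univ.norm_image_sub_le_of_norm_hasDerivWithin_le (f := Real.tanh) (C := 1)
    (x := 0) (y := x) (fun y _ => (hd y).hasDerivWithinAt) (fun y _ => by
      rw [Real.norm_of_nonneg (by positivity), div_le_one (by have := Real.cosh_pos y; positivity)]
      exact one_le_pow₀ (Real.one_le_cosh y)) trivial trivial
  simpa using h

/-- Dominated convergence in `L²`. -/
lemma tendsto_eLpNorm_two_of_dominated {ι : Type*} {l : Filter ι} [l.IsCountablyGenerated]
    (F : ι → E3 → ℂ) (G : E3 → ℝ) (hG : MemLp G 2 volume)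
    (hF : ∀ i, AEStronglyMeasurable (F i) volume)
    (hb : ∀ᶠ i in l, ∀ᵐ x, ‖F i x‖ ≤ G x)
    (hl : ∀ᵐ x, Tendsto (fun i => F i x) l (𝓝 0)) :
    Tendsto (fun i => eLpNorm (F i) 2 volume) l (𝓝 0) := by
  have hG2 : ∫⁻ x, ‖G x‖ₑ ^ (2 : ℝ) ≠ ⊤ := by
    have := hG.eLpNorm_lt_top
    rw [eLpNorm_eq_lintegral_rpow_enorm_toReal two_ne_zero ENNReal.ofNat_ne_top] at this
    simp only [ENNReal.toReal_ofNat] at this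
    intro h
    rw [h] at this
    simp at this
  have key := tendsto_lintegral_filter_of_dominated_convergence' (μ := volume) (l := l)
    (F := fun i x => ‖F i x‖ₑ ^ (2 : ℝ)) (f := fun _ => 0) (fun x => ‖G x‖ₑ ^ (2 : ℝ))
    (Eventually.of_forall fun i => ((hF i).enorm).pow_const _)
    (hb.mono fun i hi => hi.mono fun x hx => by
      refine ENNReal.rpow_le_rpow ?_ (by norm_num)
      rw [← enorm_norm (F i x)]
      have h0 : 0 ≤ G x := (norm_nonneg _).trans hx
      rw [Real.enorm_of_nonneg (norm_nonneg _), Real.enorm_of_nonneg h0]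
      exact ENNReal.ofReal_le_ofReal hx)
    hG2
    (hl.mono fun x hx => by
      have h1 : Tendsto (fun i => ‖F i x‖ₑ) l (𝓝 0) := by simpa using hx.enorm
      have h2 := (ENNReal.continuous_rpow_const (y := 2)).tendsto 0 |>.comp h1
      simpa [Function.comp_def] using h2)
  have h3 := (ENNReal.continuous_rpow_const (y := 1 / 2)).tendsto _ |>.comp key
  simp only [eLpNorm_eq_lintegral_rpow_enorm_toReal two_ne_zero ENNReal.ofNat_ne_top,
    ENNReal.toReal_ofNat]
  simpa [Function.comp_def] using h3

lemma memLp_chi (β μ : ℝ) :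
    MemLp (fun ξ : E3 => ((chi β (kineticSymbol μ ξ) : ℝ) : ℂ)) ⊤ volume := by
  have hk : Measurable (kineticSymbol μ) := by unfold kineticSymbol; fun_prop
  have ht : Measurable Real.tanh := by
    have : Real.tanh = fun x => Real.sinh x / Real.cosh x := by
      funext x; exact Real.tanh_eq_sinh_div_cosh x
    rw [this]; fun_prop
  have hc : Measurable (chi β) := by
    unfold chi
    refine Measurable.ite (measurableSet_singleton 0) measurable_const ?_
    exact (ht.comp (by fun_prop)).div measurable_id
  refine memLp_top_of_bound
    (Complex.measurable_ofReal.comp (hc.comp hk)).aestronglyMeasurable (|β| / 2)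
    (Eventually.of_forall fun ξ => ?_)
  rw [Complex.norm_real, Real.norm_eq_abs]
  unfold chi
  split_ifs with h
  · rw [abs_div]; simp
  · rw [abs_div, div_le_iff₀ (abs_pos.mpr h)]
    refine (abs_tanh_le _).trans (le_of_eq ?_)
    rw [abs_div, abs_mul]; simp; ring

/-- The operator `χ_β(p² - μ)` on `L²(ℝ³)`, with `p = -i∇`. -/
def chiOp (β μ : ℝ) : L2 →L[ℂ] L2 :=
  (Lp.fourierTransformₗᵢ E3 ℂ).symm.toContinuousLinearEquiv.toContinuousLinearMap ∘L
    mulOp _ (memLp_chi β μ) ∘L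
      (Lp.fourierTransformₗᵢ E3 ℂ).toContinuousLinearEquiv.toContinuousLinearMap

/-- The Birman–Schwinger operator `V^{1/2} χ_β(p² - μ) V^{1/2}`. -/
def birmanSchwinger (W : InteractionPotential) (μ β : ℝ) : L2 →L[ℂ] L2 :=
  W.sqrtOp ∘L chiOp β μ ∘L W.sqrtOp

/-- `sup spec V^{1/2} w(p² - μ) V^{1/2}` in `L²_symm(ℝ³)` for a non-negative function `w`, through
the variational principle, that is, as the supremum of the (possibly infinite) quadratic form
`‖w(p² - μ)^{1/2} V^{1/2} f‖²` over normalized `f`. In this way it is also defined when the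
operator is unbounded. -/
def supSpec (W : InteractionPotential) (μ : ℝ) (w : ℝ → ℝ≥0∞) : ℝ≥0∞ :=
  ⨆ (f : L2) (_ : f ∈ L2symm) (_ : ‖f‖ = 1),
    ∫⁻ ξ : E3, w (kineticSymbol μ ξ) * ‖(Lp.fourierTransformₗᵢ E3 ℂ (W.sqrtOp f) : L2) ξ‖ₑ ^ 2

/-- `sup spec V^{1/2} χ_β(p² - μ) V^{1/2}`. -/
def supSpecChi (W : InteractionPotential) (μ β : ℝ) : ℝ≥0∞ :=
  supSpec W μ fun E => ENNReal.ofReal (chi β E)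

/-- `sup spec V^{1/2} χ_∞(p² - μ) V^{1/2}` with `χ_∞(E) = |E|⁻¹`. -/
def supSpecChiInfty (W : InteractionPotential) (μ : ℝ) : ℝ≥0∞ :=
  supSpec W μ fun E => (ENNReal.ofReal |E|)⁻¹

/-- The critical inverse temperature `β_c`: the largest `β` for which
`sup spec V^{1/2} χ_β(p² - μ) V^{1/2} ≤ 1`. Since `β ↦ χ_β(E)` is strictly increasing, the latter
holds if and only if `β ≤ β_c`, provided that `sup spec V^{1/2} χ_∞(p² - μ) V^{1/2} > 1`. -/
def betaCrit (W : InteractionPotential) (μ : ℝ) : ℝ :=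
  sSup {β : ℝ | 0 < β ∧ supSpecChi W μ β ≤ 1}

/-- The eigenspace of `V^{1/2} χ_{β_c}(p² - μ) V^{1/2}` in `L²_symm(ℝ³)` for the eigenvalue `1`. -/
def critEigenspace (W : InteractionPotential) (μ : ℝ) : Submodule ℂ L2 :=
  L2symm ⊓ Module.End.eigenspace (birmanSchwinger W μ (betaCrit W μ)).toLinearMap 1

/-! ### The magnetic momentum and its exponentials -/

/-- The vector field `X ↦ 𝐁 ∧ X` with `𝐁 = B e₃`. -/
def bwedge (B : ℝ) (X : E3) : E3 := !₂[-(B * X 1), B * X 0, 0]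

/-- The `j`-th component of `Π_X = -i∇_X + 𝐁 ∧ X`, as a differential operator. -/
def magMomentum (B : ℝ) (j : Fin 3) (f : E3 → ℂ) : E3 → ℂ := fun X =>
  -Complex.I * fderiv ℝ f X (EuclideanSpace.single j 1) + (bwedge B X j : ℂ) * f X

/-- The differential expression `Π_X²`. -/
def magLaplacian (B : ℝ) (f : E3 → ℂ) : E3 → ℂ := fun X =>
  ∑ j : Fin 3, magMomentum B j (magMomentum B j f) X

/-- Smooth compactly supported functions `ℝ³ → ℂ`. -/
def IsTestFunction (f : E3 → ℂ) : Prop := ContDiff ℝ ∞ f ∧ HasCompactSupport f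

/-- `u` belongs to the form domain of `Π_X²`: it is the `L²`-limit of a sequence of test functions
which is Cauchy with respect to the quadratic form `∑ⱼ ‖Π_X^{(j)} v‖² = ⟨v, Π_X² v⟩`. -/
def MemFormDomain (B : ℝ) (u : L2) : Prop :=
  ∃ s : ℕ → E3 → ℂ, (∀ n, IsTestFunction (s n)) ∧
    Tendsto (fun n => eLpNorm (s n - ⇑u) 2 volume) atTop (𝓝 0) ∧
    ∀ j, Tendsto (fun q : ℕ × ℕ => eLpNorm (magMomentum B j (s q.1 - s q.2)) 2 volume)
      (atTop ×ˢ atTop) (𝓝 0)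

/-- `u` is in the domain of the Friedrichs extension of `Π_X²` on test functions, and this
self-adjoint operator maps `u` to `f`: it is the restriction of the adjoint to the form domain. -/
def FriedrichsMagLaplacian (B : ℝ) (u f : L2) : Prop :=
  MemFormDomain B u ∧ ∀ v : E3 → ℂ, IsTestFunction v →
    ∫ X, star (magLaplacian B v X) * u X = ∫ X, star (v X) * f X

/-- `S` is the bounded operator `Π_X² (E₀ + Π_X²)⁻¹`: for every `ψ` there is a (necessarily unique)
`u` in the domain of `Π_X²` with `(E₀ + Π_X²) u = ψ`, and `S ψ = Π_X² u`. -/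
def IsMagRatio (B E₀ : ℝ) (S : L2 →L[ℂ] L2) : Prop :=
  ∀ ψ : L2, ∃ u : L2, FriedrichsMagLaplacian B u (S ψ) ∧ (E₀ : ℂ) • u + S ψ = ψ

/-- The phase `e^{i r·(𝐁 ∧ X)}`. -/
def magPhase (B : ℝ) (r X : E3) : ℂ := Complex.exp (Complex.I * (inner ℝ r (bwedge B X) : ℝ))

/-- The magnetic translation `(e^{i r·Π_X} f)(X) = e^{i r·(𝐁 ∧ X)} f(X + r)`, on functions. -/
def magTranslate (B : ℝ) (r : E3) (f : E3 → ℂ) : E3 → ℂ := fun X => magPhase B r X * f (X + r)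

lemma continuous_bwedge (B : ℝ) : Continuous (bwedge B) := by
  unfold bwedge; fun_prop

lemma norm_magPhase (B : ℝ) (r X : E3) : ‖magPhase B r X‖ = 1 := by
  rw [magPhase, mul_comm, Complex.norm_exp_ofReal_mul_I]

lemma continuous_magPhase (B : ℝ) : Continuous fun q : E3 × E3 => magPhase B q.1 q.2 := by
  have := continuous_bwedge B
  unfold magPhase; fun_prop

lemma memLp_magPhase (B : ℝ) (r : E3) : MemLp (magPhase B r) ⊤ volume :=
  memLp_top_of_bound
    ((continuous_magPhase B).comp (Continuous.prodMk_right r)).aestronglyMeasurable 1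
    (Eventually.of_forall fun X => (norm_magPhase B r X).le)

/-- The unitary operator `e^{i r·Π_X}` on `L²(ℝ³)`, as a magnetic translation. That this is the
exponential of the self-adjoint operator `r·Π_X` is justified below: `t ↦ e^{i t r·Π_X}` is a
strongly continuous one-parameter group of isometries (`magTranslate_add`, `norm_expMag_apply`,
`continuous_expMag`) that leaves the space of test functions invariant, and its generator acts on
test functions as `i r·Π_X` (`tendsto_magTranslate`). -/
def expMag (B : ℝ) (r : E3) : L2 →L[ℂ] L2 :=
  mulOp (magPhase B r) (memLp_magPhase B r) ∘L translation r

lemma expMag_coeFn (B : ℝ) (r : E3) (f : L2) : expMag B r f =ᵐ[volume] magTranslate B r f := by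
  have h1 := mulOp_coeFn (magPhase B r) (memLp_magPhase B r) (translation r f)
  have h2 : translation r f =ᵐ[volume] fun x => f (x + r) :=
    Lp.coeFn_compMeasurePreserving f (measurePreserving_add_right volume r)
  filter_upwards [h1, h2] with x hx hy
  simp only [expMag, ContinuousLinearMap.comp_apply, magTranslate]
  rw [hx, hy]

/-- `t ↦ e^{i t r·Π_X}` is a one-parameter group. -/
lemma magTranslate_add (B s t : ℝ) (r : E3) (f : E3 → ℂ) :
    magTranslate B (s • r) (magTranslate B (t • r) f) = magTranslate B ((s + t) • r) f := by
  funext X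
  have h1 : (inner ℝ ((s + t) • r) (bwedge B X) : ℝ) =
      inner ℝ (s • r) (bwedge B X) + inner ℝ (t • r) (bwedge B (X + s • r)) := by
    simp [bwedge, PiLp.inner_apply, Fin.sum_univ_three]
    ring
  have h2 : X + (s + t) • r = X + s • r + t • r := by module
  simp only [magTranslate, magPhase]
  rw [h1, h2, Complex.ofReal_add, mul_add, Complex.exp_add, mul_assoc]

/-- The generator of `t ↦ e^{i t r·Π_X}` acts on test functions as `i r·Π_X`. -/
lemma tendsto_magTranslate (B : ℝ) (r : E3) (f : E3 → ℂ) (hf : IsTestFunction f) :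
    Tendsto (fun t : ℝ => eLpNorm (fun X => (t : ℂ)⁻¹ * (magTranslate B (t • r) f X - f X)
        - Complex.I * ∑ j : Fin 3, (r j : ℂ) * magMomentum B j f X) 2 volume)
      (𝓝[≠] 0) (𝓝 0) := by
  have hfc : Continuous f := hf.1.continuous
  have hfd : Continuous (fderiv ℝ f) := hf.1.continuous_fderiv (by simp)
  have hbw := continuous_bwedge B
  set a : E3 → ℝ := fun X => inner ℝ r (bwedge B X) with ha
  have hac : Continuous a := by fun_prop
  set h : ℝ × E3 → ℂ := fun q => magPhase B (q.1 • r) q.2 *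
    (Complex.I * a q.2 * f (q.2 + q.1 • r) + fderiv ℝ f (q.2 + q.1 • r) r) with hh
  have hmc : Continuous fun q : ℝ × E3 => magPhase B (q.1 • r) q.2 :=
    (continuous_magPhase B).comp (f := fun q : ℝ × E3 => (q.1 • r, q.2)) (by fun_prop)
  have hhc : Continuous h := by fun_prop
  have hder : ∀ X t, HasDerivAt (fun t : ℝ => magTranslate B (t • r) f X) (h (t, X)) t := by
    intro X t
    have h1 : HasDerivAt (fun t : ℝ => magPhase B (t • r) X)
        (magPhase B (t • r) X * (Complex.I * a X)) t := by
      have e : (fun t : ℝ => magPhase B (t • r) X) =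
          fun t : ℝ => Complex.exp ((t : ℂ) * (Complex.I * a X)) := by
        funext t
        simp only [magPhase, ha, inner_smul_left, RCLike.conj_to_real, Complex.ofReal_mul]
        congr 1; ring
      rw [e, show magPhase B (t • r) X = Complex.exp ((t : ℂ) * (Complex.I * a X)) from
        congrFun e t]
      have := ((Complex.ofRealCLM.hasDerivAt (x := t)).mul_const (Complex.I * (a X : ℂ))).cexp
      simpa using this
    have h2 : HasDerivAt (fun t : ℝ => f (X + t • r)) (fderiv ℝ f (X + t • r) r) t := by
      have hl : HasDerivAt (fun t : ℝ => X + t • r) r t := by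
        simpa using ((hasDerivAt_id t).smul_const r).const_add X
      exact ((hf.1.differentiable (by simp)) (X + t • r)).hasFDerivAt.comp_hasDerivAt t hl
    refine (h1.mul h2).congr_deriv ?_
    simp only [hh]; ring
  have h0 : ∀ X, h (0, X) = Complex.I * ∑ j : Fin 3, (r j : ℂ) * magMomentum B j f X := by
    intro X
    have hr : r = ∑ j : Fin 3, r j • EuclideanSpace.single j (1 : ℝ) := by
      ext i; fin_cases i <;> simp [Fin.sum_univ_three]
    have e1 : fderiv ℝ f X r =
        ∑ j : Fin 3, (r j : ℂ) * fderiv ℝ f X (EuclideanSpace.single j 1) := by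
      conv_lhs => rw [hr]
      simp [map_sum]
    have e2 : ((a X : ℝ) : ℂ) = ∑ j : Fin 3, (r j : ℂ) * (bwedge B X j : ℂ) := by
      simp [ha, PiLp.inner_apply, Fin.sum_univ_three, mul_comm]
    simp only [hh, zero_smul, add_zero, magMomentum, e1, e2]
    simp only [magPhase, inner_zero_left, Complex.ofReal_zero, mul_zero, Complex.exp_zero, one_mul,
      Fin.sum_univ_three]
    linear_combination ((r 0 : ℂ) * fderiv ℝ f X (EuclideanSpace.single 0 1)
      + (r 1 : ℂ) * fderiv ℝ f X (EuclideanSpace.single 1 1)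
      + (r 2 : ℂ) * fderiv ℝ f X (EuclideanSpace.single 2 1)) * Complex.I_sq
  set K : Set E3 := (fun q : ℝ × E3 => q.2 - q.1 • r) '' (Set.Icc (-1) 1 ×ˢ tsupport f) with hK
  have hKc : IsCompact K := (isCompact_Icc.prod hf.2).image (by fun_prop)
  have hsupp : ∀ t ∈ Set.Icc (-1 : ℝ) 1, ∀ X ∉ K, h (t, X) = 0 := by
    intro t ht X hX
    have hn : X + t • r ∉ tsupport f := fun hm => hX ⟨(t, X + t • r), ⟨ht, hm⟩, by simp⟩
    have e1 : f (X + t • r) = 0 := image_eq_zero_of_notMem_tsupport hn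
    have e2 : fderiv ℝ f (X + t • r) = 0 :=
      image_eq_zero_of_notMem_tsupport fun hm => hn (tsupport_fderiv_subset ℝ hm)
    simp [hh, e1, e2]
  have hIK : IsCompact (Set.Icc (-1 : ℝ) 1 ×ˢ K) := isCompact_Icc.prod hKc
  obtain ⟨C, hC⟩ := hIK.exists_bound_of_continuousOn hhc.continuousOn
  set G : E3 → ℝ := K.indicator fun _ => max C 0 with hGdef
  have hhb : ∀ t ∈ Set.Icc (-1 : ℝ) 1, ∀ X, ‖h (t, X)‖ ≤ G X := by
    intro t ht X
    by_cases hX : X ∈ K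
    · simp only [hGdef, Set.indicator_of_mem hX]
      exact (hC (t, X) ⟨ht, hX⟩).trans (le_max_left _ _)
    · simp [hGdef, Set.indicator_of_notMem hX, hsupp t ht X hX]
  have hG : MemLp G 2 volume :=
    memLp_indicator_const 2 hKc.measurableSet _ (Or.inr hKc.measure_lt_top.ne)
  have hz : ∀ X, magTranslate B ((0 : ℝ) • r) f X = f X := by
    intro X; simp [magTranslate, magPhase]
  have hG2 : MemLp (fun X => G X + G X) 2 volume := hG.add hG
  simp only [← h0]
  clear_value h G K
  refine tendsto_eLpNorm_two_of_dominated _ (fun X => G X + G X) hG2 ?_ ?_ ?_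
  · intro t
    have c1 : Continuous fun X => h (0, X) := by fun_prop
    have c2 : Continuous fun X => magTranslate B (t • r) f X := by
      exact (hmc.comp (g := fun q : ℝ × E3 => magPhase B (q.1 • r) q.2) (f := fun X : E3 => (t, X))
        (by fun_prop)).mul (hfc.comp (continuous_id.add continuous_const))
    exact ((continuous_const.mul (c2.sub hfc)).sub c1).aestronglyMeasurable
  · have hnear : ∀ᶠ t : ℝ in 𝓝[≠] 0, t ∈ Set.Icc (-1 : ℝ) 1 :=
      nhdsWithin_le_nhds (Icc_mem_nhds (by norm_num) (by norm_num))
    filter_upwards [hnear, self_mem_nhdsWithin] with t ht htne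
    refine Eventually.of_forall fun X => ?_
    refine (norm_sub_le _ _).trans (add_le_add ?_ (hhb 0 (by simp) X))
    have hmv := (convex_Icc (-1 : ℝ) 1).norm_image_sub_le_of_norm_hasDerivWithin_le
      (f := fun t : ℝ => magTranslate B (t • r) f X) (C := G X) (x := 0) (y := t)
      (fun s _ => (hder X s).hasDerivWithinAt) (fun s hs => hhb s hs X) (by simp) ht
    simp only [hz, sub_zero] at hmv
    have htp : 0 < |t| := abs_pos.mpr htne
    rw [norm_mul, norm_inv, Complex.norm_real, Real.norm_eq_abs, inv_mul_le_iff₀ htp]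
    simpa [mul_comm] using hmv
  · refine Eventually.of_forall fun X => ?_
    have hs := (hasDerivAt_iff_tendsto_slope.mp (hder X 0))
    have := hs.sub_const (h (0, X))
    rw [sub_self] at this
    refine this.congr fun t => ?_
    simp only [slope, hz, vsub_eq_sub, sub_zero, Complex.real_smul, Complex.ofReal_inv]

lemma norm_expMag_apply (B : ℝ) (r : E3) (f : L2) : ‖expMag B r f‖ = ‖f‖ := by
  have h : ‖expMag B r f‖ = ‖translation r f‖ := by
    rw [Lp.norm_def, Lp.norm_def]
    congr 1
    refine eLpNorm_congr_norm_ae ?_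
    filter_upwards [mulOp_coeFn (magPhase B r) (memLp_magPhase B r) (translation r f)] with x hx
    simp only [expMag, ContinuousLinearMap.comp_apply]
    rw [hx, norm_mul, norm_magPhase, one_mul]
  rw [h]
  exact LinearIsometry.norm_map _ f

lemma continuous_translation (f : L2) : Continuous fun r => translation r f := by
  have hg : Continuous fun r : E3 => (⟨fun x => x + r, by fun_prop⟩ : C(E3, E3)) :=
    ContinuousMap.continuous_of_continuous_uncurry _ (by
      simp only [Function.uncurry_def, ContinuousMap.coe_mk]; fun_prop)
  exact (continuous_const (y := f)).compMeasurePreservingLp hg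
    (fun r => measurePreserving_add_right volume r) (by norm_num)

lemma continuous_expMag (B : ℝ) (f : L2) : Continuous fun r => expMag B r f := by
  rw [continuous_iff_continuousAt]
  intro r₀
  set g := translation r₀ f with hg
  have hm : ∀ r, ‖mulOp (magPhase B r) (memLp_magPhase B r) (translation r f - g)‖
      = ‖translation r f - g‖ := fun r => by
    rw [Lp.norm_def, Lp.norm_def]
    congr 1
    refine eLpNorm_congr_norm_ae ?_
    filter_upwards [mulOp_coeFn (magPhase B r) (memLp_magPhase B r) (translation r f - g)]
      with x hx
    rw [hx, norm_mul, norm_magPhase, one_mul]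
  have h1 : Tendsto (fun r => mulOp (magPhase B r) (memLp_magPhase B r) (translation r f - g))
      (𝓝 r₀) (𝓝 0) := by
    rw [tendsto_zero_iff_norm_tendsto_zero]
    simp only [hm]
    rw [← tendsto_zero_iff_norm_tendsto_zero]
    have := (continuous_translation f).tendsto r₀
    simpa [hg] using this.sub_const g
  have h2 : Tendsto (fun r => mulOp (magPhase B r) (memLp_magPhase B r) g)
      (𝓝 r₀) (𝓝 (mulOp (magPhase B r₀) (memLp_magPhase B r₀) g)) := by
    rw [Lp.tendsto_Lp_iff_tendsto_eLpNorm']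
    have h3 := tendsto_eLpNorm_two_of_dominated (l := 𝓝 r₀)
      (fun r X => (magPhase B r X - magPhase B r₀ X) * g X) (fun X => 2 * ‖g X‖)
      ((Lp.memLp g).norm.const_mul 2)
      (fun r => ((memLp_magPhase B r).aestronglyMeasurable.sub
        (memLp_magPhase B r₀).aestronglyMeasurable).mul (Lp.memLp g).aestronglyMeasurable)
      (Eventually.of_forall fun r => Eventually.of_forall fun X => by
        rw [norm_mul]
        gcongr
        refine (norm_sub_le _ _).trans ?_
        rw [norm_magPhase, norm_magPhase]; norm_num)
      (Eventually.of_forall fun X => by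
        have hc : Continuous fun r => (magPhase B r X - magPhase B r₀ X) * g X :=
          (((continuous_magPhase B).comp (Continuous.prodMk_left X)).sub continuous_const).mul
            continuous_const
        simpa using hc.tendsto r₀)
    refine h3.congr fun r => eLpNorm_congr_ae ?_
    filter_upwards [mulOp_coeFn (magPhase B r) (memLp_magPhase B r) g,
      mulOp_coeFn (magPhase B r₀) (memLp_magPhase B r₀) g] with X h4 h5
    simp only [Pi.sub_apply, h4, h5]
    ring
  have h3 := h1.add h2
  simp only [← map_add, sub_add_cancel, zero_add] at h3
  exact h3

/-- `cos(r·Π_X) = (e^{i r·Π_X} + e^{-i r·Π_X})/2`. -/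
def cosMag (B : ℝ) (r : E3) : L2 →L[ℂ] L2 := (1 / 2 : ℂ) • (expMag B r + expMag B (-r))

lemma norm_cosMag_apply_le (B : ℝ) (r : E3) (f : L2) : ‖cosMag B r f‖ ≤ ‖f‖ := by
  have h : ‖expMag B r f + expMag B (-r) f‖ ≤ ‖f‖ + ‖f‖ :=
    (norm_add_le _ _).trans (by rw [norm_expMag_apply, norm_expMag_apply])
  simp only [cosMag, smul_apply, add_apply, norm_smul]
  norm_num
  linarith

lemma integrable_norm_sq (φ : L2) : Integrable (fun r : E3 => ‖φ r‖ ^ 2) volume :=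
  (Lp.memLp φ).integrable_norm_pow (by norm_num)

lemma integrable_cosMag (B : ℝ) (φ ψ : L2) :
    Integrable (fun r : E3 => (‖φ r‖ ^ 2 : ℝ) • cosMag B r ψ) volume := by
  have hc : Continuous fun r => cosMag B r ψ := by
    have h1 := continuous_expMag B ψ
    have h2 := h1.comp continuous_neg
    simp only [cosMag, smul_apply, add_apply]
    exact (h1.add h2).const_smul (1 / 2 : ℂ)
  refine Integrable.mono' ((integrable_norm_sq φ).mul_const ‖ψ‖)
    ((integrable_norm_sq φ).aestronglyMeasurable.smul hc.aestronglyMeasurable)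
    (Eventually.of_forall fun r => ?_)
  rw [norm_smul, Real.norm_of_nonneg (by positivity)]
  gcongr
  exact norm_cosMag_apply_le B r ψ

/-- The operator `R = ∫ |φ(r)|² cos(r·Π_X) dr` on `L²(ℝ³)` (a strong integral). -/
def opR (B : ℝ) (φ : L2) : L2 →L[ℂ] L2 :=
  LinearMap.mkContinuous
    { toFun := fun ψ => ∫ r : E3, (‖φ r‖ ^ 2 : ℝ) • cosMag B r ψ
      map_add' := fun ψ₁ ψ₂ => by
        simp only [map_add, smul_add]
        exact integral_add (integrable_cosMag B φ ψ₁) (integrable_cosMag B φ ψ₂)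
      map_smul' := fun a ψ => by
        simp only [map_smul, RingHom.id_apply]
        rw [← integral_smul]
        congr 1
        funext r
        exact smul_comm _ _ _ }
    (∫ r : E3, ‖φ r‖ ^ 2)
    (fun ψ => by
      refine (norm_integral_le_of_norm_le ((integrable_norm_sq φ).mul_const ‖ψ‖)
        (Eventually.of_forall fun r => ?_)).trans (le_of_eq (integral_mul_const _ _))
      rw [norm_smul, Real.norm_of_nonneg (by positivity)]
      gcongr
      exact norm_cosMag_apply_le B r ψ)

end

noncomputable section

/-! ### Weyl relations and the basic quadratic form bound -/

/-! Write `T_r` for the magnetic translation `e^{i r·Π}`. The defect `‖ψ‖² - ‖Rψ‖²` controls how far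
magnetic translations move `ψ`, and a vector that all short magnetic translations move little is
close to the form domain of `Π²`.

Since `cos² = 1 - sin²` and `R` is an average of cosines, Jensen's inequality bounds the defect
below by a quarter of the mean of `‖T_{2s} ψ - ψ‖²` under the density `|φ(s)|²`
(`meanDisplacement_le`).

This mean only sees those `s` where `φ` lives. As in Steinhaus' theorem, every small `r` is a
difference `s - t` of points of a set `A` on which `|φ|²` is bounded below, and in many ways;
averaging over them bounds `‖T_r ψ - ψ‖²` for all small `r` (`exists_norm_expMag_sub_sq_le`).
Translations commute only up to a Weyl phase (`expMag_comp`). The two orders of the product give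
opposite phases, and for small phases both can be removed at the cost of a factor 2
(`norm_sub_le_of_phase`).

Finally let `u = ∫ h(r) T_r ψ dr` with a smooth bump `h`. Then `ψ - u` is an average of small
displacements, and so is `Π_j u` after an integration by parts that moves the derivative to `h`
(`exists_mem_magGraphClosure_near`). As the form of `Π² (1 + Π²)⁻¹` at `ψ` is at most `‖ψ - u‖² + ‖Π
u‖²` for every `u` in the form domain (`exists_isMagRatio`), it is bounded by the displacements,
hence by the defect (`exists_magRatio_form_le`). All constants depend on the field only through
`B₀`. -/

lemma expMag_comp (B : ℝ) (a b : E3) (f : L2) :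
    expMag B a (expMag B b f) =
      Complex.exp (Complex.I * (inner ℝ b (bwedge B a) : ℝ)) • expMag B (a + b) f := by
  apply Lp.ext
  have h2 := (measurePreserving_add_right volume a).quasiMeasurePreserving.ae_eq_comp
    (expMag_coeFn B b f)
  filter_upwards [expMag_coeFn B a (expMag B b f), h2, expMag_coeFn B (a + b) f,
    Lp.coeFn_smul (Complex.exp (Complex.I * (inner ℝ b (bwedge B a) : ℝ))) (expMag B (a + b) f)]
    with X h1 h2 h3 h4
  simp only [Function.comp_apply] at h2
  rw [h1, h4, Pi.smul_apply, h3, magTranslate, h2]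
  simp only [magTranslate, magPhase, smul_eq_mul, ← mul_assoc, ← Complex.exp_add]
  have e : X + a + b = X + (a + b) := by abel
  rw [e]
  congr 2
  rw [← mul_add, ← mul_add, ← Complex.ofReal_add, ← Complex.ofReal_add]
  congr 2
  simp [bwedge, PiLp.inner_apply, Fin.sum_univ_three]
  ring

lemma inner_bwedge_self (B : ℝ) (a : E3) : inner ℝ a (bwedge B a) = 0 := by
  simp [bwedge, PiLp.inner_apply, Fin.sum_univ_three]; ring

lemma inner_bwedge_comm (B : ℝ) (a b : E3) :
    inner ℝ a (bwedge B b) = - inner ℝ b (bwedge B a) := by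
  simp [bwedge, PiLp.inner_apply, Fin.sum_univ_three]; ring

lemma bwedge_add (B : ℝ) (a b : E3) : bwedge B (a + b) = bwedge B a + bwedge B b := by
  ext i; fin_cases i <;> simp [bwedge] <;> ring

lemma bwedge_smul (B t : ℝ) (a : E3) : bwedge B (t • a) = t • bwedge B a := by
  ext i; fin_cases i <;> simp [bwedge] <;> ring

lemma norm_bwedge_le (B : ℝ) (a : E3) : ‖bwedge B a‖ ≤ |B| * ‖a‖ := by
  rw [EuclideanSpace.norm_eq, EuclideanSpace.norm_eq, ← Real.sqrt_sq_eq_abs,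
    ← Real.sqrt_mul (sq_nonneg B)]
  apply Real.sqrt_le_sqrt
  simp [bwedge, Fin.sum_univ_three]
  nlinarith [mul_nonneg (sq_nonneg B) (sq_nonneg (a 2))]

lemma expMag_zero (B : ℝ) (f : L2) : expMag B 0 f = f := by
  apply Lp.ext
  filter_upwards [expMag_coeFn B 0 f] with X h
  simp [h, magTranslate, magPhase]

lemma expMag_neg_expMag (B : ℝ) (a : E3) (f : L2) : expMag B (-a) (expMag B a f) = f := by
  rw [expMag_comp, inner_bwedge_comm, ← neg_one_smul ℝ a, inner_smul_left, inner_bwedge_self]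
  simp [expMag_zero]

lemma expMag_expMag_self (B : ℝ) (a : E3) (f : L2) :
    expMag B a (expMag B a f) = expMag B ((2 : ℝ) • a) f := by
  rw [expMag_comp, inner_bwedge_self, two_smul]; simp

lemma inner_expMag (B : ℝ) (a : E3) (f g : L2) :
    inner ℂ (expMag B a f) g = inner ℂ f (expMag B (-a) g) := by
  have h := (LinearIsometry.mk (expMag B (-a)).toLinearMap
    (norm_expMag_apply B (-a))).inner_map_map (expMag B a f) g
  rw [← h]
  change inner ℂ (expMag B (-a) (expMag B a f)) (expMag B (-a) g) = _
  rw [expMag_neg_expMag]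

lemma inner_cosMag (B : ℝ) (a : E3) (f g : L2) :
    inner ℂ (cosMag B a f) g = inner ℂ f (cosMag B a g) := by
  simp only [cosMag, smul_apply, add_apply, inner_smul_left, inner_smul_right, inner_add_left,
    inner_add_right, inner_expMag, neg_neg, map_div₀, map_one, map_ofNat]
  ring

lemma opR_apply (B : ℝ) (φ ψ : L2) :
    opR B φ ψ = ∫ r : E3, (‖φ r‖ ^ 2 : ℝ) • cosMag B r ψ := rfl

lemma inner_opR (B : ℝ) (φ f g : L2) :
    inner ℂ (opR B φ f) g = inner ℂ f (opR B φ g) := by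
  rw [opR_apply, opR_apply, ← inner_conj_symm, ← integral_inner (integrable_cosMag B φ f),
    ← integral_inner (integrable_cosMag B φ g), ← integral_conj]
  congr 1
  funext r
  rw [inner_conj_symm, inner_smul_left_eq_smul, inner_smul_right_eq_smul, inner_cosMag]

/-- This is `cos² = 1 - sin²`, read off from the parallelogram law for `T_r ψ` and `T_{-r} ψ`.
Applying the isometry `T_r` to their difference produces the translation by `2r`. -/
lemma norm_sq_sub_norm_cosMag_sq (B : ℝ) (r : E3) (ψ : L2) :
    ‖cosMag B r ψ‖ ^ 2 = ‖ψ‖ ^ 2 - ‖expMag B ((2 : ℝ) • r) ψ - ψ‖ ^ 2 / 4 := by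
  have h := parallelogram_law_with_norm ℂ (expMag B r ψ) (expMag B (-r) ψ)
  have e : ‖expMag B r ψ - expMag B (-r) ψ‖ = ‖expMag B ((2 : ℝ) • r) ψ - ψ‖ := by
    rw [← norm_expMag_apply B r (_ - _), map_sub, expMag_expMag_self]
    congr 2
    simpa using expMag_neg_expMag B (-r) ψ
  rw [e, norm_expMag_apply, norm_expMag_apply] at h
  simp only [cosMag, smul_apply, add_apply, norm_smul]
  norm_num
  nlinarith

/-- The mean square displacement of `ψ` under the magnetic translations `e^{2 i s·Π}`, with `s`
distributed according to `|φ|²`. -/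
def meanDisplacement (B : ℝ) (φ ψ : L2) : ℝ :=
  ∫ s : E3, ‖φ s‖ ^ 2 * ‖expMag B ((2 : ℝ) • s) ψ - ψ‖ ^ 2

lemma continuous_norm_expMag_sub (B : ℝ) (ψ : L2) :
    Continuous fun s : E3 => ‖expMag B ((2 : ℝ) • s) ψ - ψ‖ :=
  (((continuous_expMag B ψ).comp (continuous_const_smul (2 : ℝ))).sub continuous_const).norm

lemma norm_expMag_sub_le (B : ℝ) (r : E3) (ψ : L2) : ‖expMag B r ψ - ψ‖ ≤ 2 * ‖ψ‖ := by
  refine (norm_sub_le _ _).trans ?_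
  rw [norm_expMag_apply]; linarith

lemma integrable_meanDisplacement (B : ℝ) (φ ψ : L2) :
    Integrable fun s : E3 => ‖φ s‖ ^ 2 * ‖expMag B ((2 : ℝ) • s) ψ - ψ‖ ^ 2 := by
  refine (integrable_norm_sq φ).mul_bdd (c := (2 * ‖ψ‖) ^ 2)
    ((continuous_norm_expMag_sub B ψ).pow 2).aestronglyMeasurable (Eventually.of_forall fun s => ?_)
  rw [Real.norm_of_nonneg (by positivity)]
  gcongr
  exact norm_expMag_sub_le _ _ _

lemma integral_norm_sq_eq (φ : L2) : ∫ r : E3, ‖φ r‖ ^ 2 = ‖φ‖ ^ 2 := by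
  have h := L2.inner_def (𝕜 := ℂ) φ φ
  rw [inner_self_eq_norm_sq_to_K] at h
  have e : (∫ a, inner ℂ (φ a) (φ a) : ℂ) = ((∫ a, ‖φ a‖ ^ 2 : ℝ) : ℂ) := by
    rw [← integral_complex_ofReal]
    congr 1
    funext a
    rw [inner_self_eq_norm_sq_to_K]; simp
  rw [e] at h
  exact Complex.ofReal_injective (h.symm.trans (by simp))

/-- Jensen's inequality for the probability density `|φ|²`, followed by `norm_sq_sub_norm_cosMag_sq`
under the integral. -/
lemma meanDisplacement_le (B : ℝ) (φ ψ : L2) (hφ : ‖φ‖ = 1) :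
    meanDisplacement B φ ψ / 4 ≤ ‖ψ‖ ^ 2 - ‖opR B φ ψ‖ ^ 2 := by
  set ρ : E3 → ℝ := fun r => ‖φ r‖ ^ 2 with hρ
  set m := ‖opR B φ ψ‖ with hm
  have hρi : Integrable ρ := integrable_norm_sq φ
  have hρ1 : ∫ r, ρ r = 1 := by rw [integral_norm_sq_eq, hφ]; norm_num
  have h1 : Integrable fun r => ρ r * ‖cosMag B r ψ‖ := by
    refine (integrable_cosMag B φ ψ).norm.congr (Eventually.of_forall fun r => ?_)
    simp [norm_smul, hρ]
  have hD := integrable_meanDisplacement B φ ψ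
  have e2 : ∀ r, ρ r * ‖cosMag B r ψ‖ ^ 2 =
      ρ r * ‖ψ‖ ^ 2 - ‖φ r‖ ^ 2 * ‖expMag B ((2 : ℝ) • r) ψ - ψ‖ ^ 2 / 4 := fun r => by
    rw [norm_sq_sub_norm_cosMag_sq]; simp only [hρ]; ring
  have h2 : Integrable fun r => ρ r * ‖cosMag B r ψ‖ ^ 2 := by
    simp only [e2]
    exact (hρi.mul_const _).sub (hD.div_const _)
  have i2 : ∫ r, ρ r * ‖cosMag B r ψ‖ ^ 2 = ‖ψ‖ ^ 2 - meanDisplacement B φ ψ / 4 := by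
    simp only [e2]
    rw [integral_sub (hρi.mul_const _) (hD.div_const _), integral_mul_const, hρ1, one_mul,
      integral_div, meanDisplacement]
  have hm1 : m ≤ ∫ r, ρ r * ‖cosMag B r ψ‖ := by
    refine (norm_integral_le_integral_norm _).trans (le_of_eq ?_)
    congr 1; funext r; simp [norm_smul, hρ]
  -- Expanding this square around `m` and using `hm1` gives `m² ≤ ∫ ρ ‖cos ψ‖²`, so convexity needs
  -- no separate appeal.
  have hsq : 0 ≤ ∫ r, ρ r * (‖cosMag B r ψ‖ - m) ^ 2 := by
    refine integral_nonneg fun r => ?_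
    simp only [hρ, Pi.zero_apply]; positivity
  have e3 : ∫ r, ρ r * (‖cosMag B r ψ‖ - m) ^ 2 = (∫ r, ρ r * ‖cosMag B r ψ‖ ^ 2)
      - 2 * m * (∫ r, ρ r * ‖cosMag B r ψ‖) + m ^ 2 := by
    have : ∀ r, ρ r * (‖cosMag B r ψ‖ - m) ^ 2 =
        (ρ r * ‖cosMag B r ψ‖ ^ 2 - 2 * m * (ρ r * ‖cosMag B r ψ‖)) + ρ r * m ^ 2 := fun r => by
      ring
    simp only [this]
    rw [integral_add (f := fun r => ρ r * ‖cosMag B r ψ‖ ^ 2 - 2 * m * (ρ r * ‖cosMag B r ψ‖))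
      (h2.sub (h1.const_mul _)) (hρi.mul_const _), integral_sub h2 (h1.const_mul _),
      integral_const_mul, integral_mul_const, hρ1, one_mul]
  have hm0 : 0 ≤ m := norm_nonneg _
  nlinarith [mul_le_mul_of_nonneg_left hm1 hm0]

/-! ### Small magnetic translations -/

lemma norm_expMag_neg_sub (B : ℝ) (r : E3) (ψ : L2) :
    ‖expMag B (-r) ψ - ψ‖ = ‖expMag B r ψ - ψ‖ := by
  rw [← norm_expMag_apply B r (expMag B (-r) ψ - ψ), map_sub]
  have := expMag_neg_expMag B (-r) ψ
  rw [neg_neg] at this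
  rw [this, norm_sub_rev]

/-- If two unimodular multiples `e^{±iθ} v` with `|θ| ≤ 1` are close to `w`, then so is `v`. -/
lemma norm_sub_le_of_phase {v w : L2} {θ d : ℝ} (hθ : |θ| ≤ 1) 
    (h1 : ‖Complex.exp (Complex.I * θ) • v - w‖ ≤ d)
    (h2 : ‖Complex.exp (Complex.I * (-θ : ℝ)) • v - w‖ ≤ d) : ‖v - w‖ ≤ 2 * d := by
  -- The half sum of the two hypotheses controls `cos θ • v - w`, the half difference controls `sin
  -- θ • v`. The remaining error `1 - cos θ` is at most `|sin θ|` exactly because `cos θ ≥ 0`.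
  have hc : 0 ≤ Real.cos θ := by
    have := Real.pi_gt_three
    refine Real.cos_nonneg_of_mem_Icc ⟨?_, ?_⟩ <;> linarith [abs_le.mp hθ]
  have ec : Complex.exp (Complex.I * θ) = Real.cos θ + Real.sin θ * Complex.I := by
    rw [mul_comm, Complex.exp_mul_I]; simp
  have es : Complex.exp (Complex.I * (-θ : ℝ)) = Real.cos θ - Real.sin θ * Complex.I := by
    rw [mul_comm, Complex.exp_mul_I]; simp; ring
  have hcos : ‖((Real.cos θ : ℝ) : ℂ) • v - w‖ ≤ d := by
    have e : ((Real.cos θ : ℝ) : ℂ) • v - w = (1 / 2 : ℂ) •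
        ((Complex.exp (Complex.I * θ) • v - w) + (Complex.exp (Complex.I * (-θ : ℝ)) • v - w)) := by
      rw [ec, es]; module
    rw [e, norm_smul]
    have := norm_add_le (Complex.exp (Complex.I * θ) • v - w)
      (Complex.exp (Complex.I * (-θ : ℝ)) • v - w)
    rw [show ‖(1 / 2 : ℂ)‖ = 1 / 2 by norm_num]
    linarith
  have hsin : |Real.sin θ| * ‖v‖ ≤ d := by
    have e : (((Real.sin θ : ℝ) : ℂ) * Complex.I) • v = (1 / 2 : ℂ) •
        ((Complex.exp (Complex.I * θ) • v - w) - (Complex.exp (Complex.I * (-θ : ℝ)) • v - w)) := by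
      rw [ec, es]; module
    have e' : |Real.sin θ| * ‖v‖ = ‖(((Real.sin θ : ℝ) : ℂ) * Complex.I) • v‖ := by
      rw [norm_smul, norm_mul, Complex.norm_real]; simp
    rw [e', e, norm_smul]
    have := norm_sub_le (Complex.exp (Complex.I * θ) • v - w)
      (Complex.exp (Complex.I * (-θ : ℝ)) • v - w)
    rw [show ‖(1 / 2 : ℂ)‖ = 1 / 2 by norm_num]
    linarith
  have hcs : 1 - Real.cos θ ≤ |Real.sin θ| := by
    have h := Real.sin_sq_add_cos_sq θ
    have := Real.cos_le_one θ
    refine (le_abs_self _).trans (sq_le_sq.mp ?_)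
    nlinarith
  have e : v - w = (((Real.cos θ : ℝ) : ℂ) • v - w) + ((1 - Real.cos θ : ℝ) : ℂ) • v := by
    push_cast; module
  rw [e]
  refine (norm_add_le _ _).trans ?_
  rw [norm_smul, Complex.norm_real, Real.norm_of_nonneg (by linarith [Real.cos_le_one θ])]
  nlinarith [norm_nonneg v]

/-- Both `T_{2s} T_{-2t}` and `T_{-2t} T_{2s}` equal `T_{2(s-t)}` up to phases `e^{iθ}` and
`e^{-iθ}`, and each moves `ψ` by at most the sum of the two displacements. By antisymmetry `θ = 4 (s
- t)·(𝐁 ∧ t)`, so the phase is small when `s` and `t` are close. -/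
lemma norm_expMag_sub_add_le (B : ℝ) (s t : E3) (ψ : L2)
    (hθ : 4 * |B| * (‖s - t‖ * ‖t‖) ≤ 1) :
    ‖expMag B ((2 : ℝ) • (s - t)) ψ - ψ‖ ≤
      2 * (‖expMag B ((2 : ℝ) • s) ψ - ψ‖ + ‖expMag B ((2 : ℝ) • t) ψ - ψ‖) := by
  set d : E3 → ℝ := fun s => ‖expMag B ((2 : ℝ) • s) ψ - ψ‖ with hd
  set θ : ℝ := 4 * inner ℝ s (bwedge B t) with hθd
  have hθ1 : |θ| ≤ 1 := by
    have e : inner ℝ s (bwedge B t) = inner ℝ (s - t) (bwedge B t) := by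
      rw [inner_sub_left, inner_bwedge_self, sub_zero]
    rw [hθd, e, abs_mul]
    refine le_trans ?_ hθ
    have h1 := abs_real_inner_le_norm (s - t) (bwedge B t)
    have h2 := mul_le_mul_of_nonneg_left (norm_bwedge_le B t) (norm_nonneg (s - t))
    rw [abs_of_pos (by norm_num : (0 : ℝ) < 4)]
    nlinarith
  have htri : ∀ a b : E3, ‖expMag B a (expMag B (-b) ψ) - ψ‖ ≤
      ‖expMag B a ψ - ψ‖ + ‖expMag B b ψ - ψ‖ := fun a b => by
    have e : expMag B a (expMag B (-b) ψ) - ψ =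
      expMag B a (expMag B (-b) ψ - ψ) + (expMag B a ψ - ψ) := by rw [map_sub]; abel
    rw [e]
    refine (norm_add_le _ _).trans ?_
    rw [norm_expMag_apply, norm_expMag_neg_sub, add_comm]
  refine norm_sub_le_of_phase (θ := θ) hθ1 ?_ ?_
  · have h := htri ((2 : ℝ) • s) ((2 : ℝ) • t)
    rw [expMag_comp] at h
    have e : inner ℝ (-((2 : ℝ) • t)) (bwedge B ((2 : ℝ) • s)) = θ := by
      rw [bwedge_smul, inner_neg_left, inner_smul_left, inner_smul_right, inner_bwedge_comm B t s]
      simp [hθd]; ring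
    rw [e] at h
    rw [smul_sub, sub_eq_add_neg ((2 : ℝ) • s)]
    exact h
  · have h := htri (-((2 : ℝ) • t)) (-((2 : ℝ) • s))
    rw [neg_neg, expMag_comp, norm_expMag_neg_sub, norm_expMag_neg_sub] at h
    have e : inner ℝ ((2 : ℝ) • s) (bwedge B (-((2 : ℝ) • t))) = -θ := by
      rw [← neg_smul, bwedge_smul, inner_smul_left, inner_smul_right]
      simp [hθd]; ring
    rw [e, add_comm (-((2 : ℝ) • t)), ← sub_eq_add_neg, ← smul_sub] at h
    linarith

/-! ### From the mean displacement to all small displacements -/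

section Steinhaus

open scoped Pointwise

/-- A nonzero density is bounded below on a compact set of positive measure and of arbitrarily
small extent. -/
lemma exists_isCompact_lower_bound (φ : L2) (hφ : φ ≠ 0) (b : ℝ) :
    ∃ A : Set E3, IsCompact A ∧ 0 < volume A ∧ (∃ ε > 0, ∀ s ∈ A, ε ≤ ‖φ s‖ ^ 2) ∧
      ∀ s ∈ A, ∀ t ∈ A, b * (‖s - t‖ * ‖t‖) ≤ 1 := by
  have hφ0 : ∃ n : ℕ, volume {s : E3 | ((n : ℝ) + 1)⁻¹ ≤ ‖φ s‖ ^ 2} ≠ 0 := by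
    by_contra! h
    refine hφ (Lp.ext ?_)
    filter_upwards [Lp.coeFn_zero ℂ 2 (volume : Measure E3),
      ae_all_iff.mpr fun n : ℕ => (measure_eq_zero_iff_ae_notMem.mp (h n))] with s h0 hs
    rw [h0]
    by_contra hne
    have hpos : 0 < ‖φ s‖ ^ 2 := by
      have : 0 < ‖φ s‖ := norm_pos_iff.mpr hne
      positivity
    obtain ⟨n, hn⟩ := exists_nat_one_div_lt hpos
    exact hs n (by simpa using hn.le)
  obtain ⟨n, hn⟩ := hφ0
  set Q := {s : E3 | ((n : ℝ) + 1)⁻¹ ≤ ‖φ s‖ ^ 2} with hQ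
  have hQm : MeasurableSet Q :=
    measurableSet_le measurable_const ((Lp.stronglyMeasurable φ).measurable.norm.pow_const 2)
  -- Every neighbourhood of `s₀` meets `Q` in positive measure, so `Q` may be cut down to a small
  -- ball; the extent condition holds there because `‖s - t‖ ‖t‖` is continuous and vanishes at
  -- `(s₀, s₀)`.
  obtain ⟨s₀, -, hs₀⟩ := exists_mem_forall_mem_nhdsWithin_pos_measure hn
  have hκ : ∃ κ > 0, ∀ s ∈ Metric.ball s₀ κ, ∀ t ∈ Metric.ball s₀ κ,
      b * (‖s - t‖ * ‖t‖) ≤ 1 := by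
    have hc : ContinuousAt (fun q : E3 × E3 => b * (‖q.1 - q.2‖ * ‖q.2‖)) (s₀, s₀) := by fun_prop
    have := hc.eventually_le_const (u := 1) (by simp)
    rw [nhds_prod_eq, ((Metric.nhds_basis_ball (x := s₀)).prod_self).eventually_iff] at this
    obtain ⟨κ, hκ, h⟩ := this
    exact ⟨κ, hκ, fun s hs t ht => h (x := (s, t)) ⟨hs, ht⟩⟩
  obtain ⟨κ, hκ, hb⟩ := hκ
  have hpos : 0 < volume (Q ∩ Metric.ball s₀ κ) :=
    hs₀ _ (inter_mem_nhdsWithin _ (Metric.ball_mem_nhds _ hκ))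
  obtain ⟨A, hA, hAc, hA0⟩ :=
    (hQm.inter measurableSet_ball).exists_lt_isCompact hpos
  exact ⟨A, hAc, hA0, ⟨((n : ℝ) + 1)⁻¹, by positivity, fun s hs => (hA hs).1⟩,
    fun s hs t ht => hb s (hA hs).2 t (hA ht).2⟩

/-- On `A` the weight `ε⁻¹ |φ|²` is at least one, and off `A` the integrand is non-negative. -/
lemma setIntegral_le_meanDisplacement (B : ℝ) (φ ψ : L2) {A : Set E3} (hA : IsCompact A)
    {ε : ℝ} (hε : 0 < ε) (hφ : ∀ s ∈ A, ε ≤ ‖φ s‖ ^ 2) :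
    ∫ s in A, ‖expMag B ((2 : ℝ) • s) ψ - ψ‖ ^ 2 ≤ ε⁻¹ * meanDisplacement B φ ψ := by
  have hi := (integrable_meanDisplacement B φ ψ).const_mul ε⁻¹
  rw [meanDisplacement, ← integral_const_mul]
  refine le_trans ?_ (setIntegral_le_integral (s := A) hi
    (Eventually.of_forall fun s => by simp only [Pi.zero_apply]; positivity))
  refine setIntegral_mono_on
    (((continuous_norm_expMag_sub B ψ).pow 2).continuousOn.integrableOn_compact hA)
    hi.integrableOn hA.measurableSet fun s hs => ?_
  rw [← mul_assoc]
  refine le_mul_of_one_le_left (sq_nonneg _) ?_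
  rw [inv_mul_eq_div, one_le_div hε]
  exact hφ s hs

/-- The displacement of `ψ` under small magnetic translations is bounded by its mean displacement,
uniformly for bounded magnetic fields. -/
lemma exists_norm_expMag_sub_sq_le (φ : L2) (hφ : φ ≠ 0) (B₀ : ℝ) :
    ∃ K > 0, ∃ δ > 0, ∀ B, |B| ≤ B₀ → ∀ ψ : L2, ∀ r : E3, ‖r‖ ≤ δ →
      ‖expMag B r ψ - ψ‖ ^ 2 ≤ K * meanDisplacement B φ ψ := by
  -- The factor `4 * B₀` matches the phase condition of `norm_expMag_sub_add_le`; thus `A` and `δ`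
  -- serve all fields up to `B₀`.
  obtain ⟨A, hAc, hA0, ⟨ε, hε, hφA⟩, hb⟩ := exists_isCompact_lower_bound φ hφ (4 * B₀)
  have hAf : volume A ≠ ⊤ := hAc.measure_lt_top.ne
  set a := (volume A).toReal with ha
  have ha0 : 0 < a := ENNReal.toReal_pos hA0.ne' hAf
  have ht := tendsto_measure_vadd_sdiff_isCompact_isClosed (μ := (volume : Measure E3)) hAc
    hAc.isClosed
  -- For small `r` the set `r + A` loses at most half of its measure outside `A`, so at least `a /
  -- 2` of the points `s` in `A` have `s - r` in `A` as well.
  have ht' := ht.eventually_le_const (u := ENNReal.ofReal (a / 2)) (by simpa using ha0)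
  obtain ⟨δ, hδ, hδr⟩ := Metric.eventually_nhds_iff_ball.mp ht'
  refine ⟨32 / a * ε⁻¹, by positivity, δ, hδ, fun B hB ψ r' hr' => ?_⟩
  obtain ⟨r, rfl⟩ : ∃ r, r' = (2 : ℝ) • r := ⟨(2 : ℝ)⁻¹ • r', by simp⟩
  have hr : ‖r‖ < δ := by
    rw [norm_smul] at hr'
    norm_num at hr'
    linarith [norm_nonneg r]
  set d : E3 → ℝ := fun s => ‖expMag B ((2 : ℝ) • s) ψ - ψ‖ ^ 2 with hd
  have hdc : Continuous d := (continuous_norm_expMag_sub B ψ).pow 2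
  have hd0 : ∀ s, 0 ≤ d s := fun s => sq_nonneg _
  set A' := A ∩ (r +ᵥ A) with hA'
  have hmA : MeasurableSet (r +ᵥ A) := hAc.measurableSet.const_vadd r
  have hA'm : MeasurableSet A' := hAc.measurableSet.inter hmA
  have hvadd : volume (r +ᵥ A) = volume A := measure_vadd _ _ _
  have hA'v : a / 2 ≤ volume.real A' := by
    have h1 := measureReal_inter_add_sdiff (μ := volume) (s := r +ᵥ A) hAc.measurableSet
      (by rw [hvadd]; exact hAf)
    have h2 : volume.real ((r +ᵥ A) \ A) ≤ a / 2 :=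
      ENNReal.toReal_le_of_le_ofReal (by positivity) (hδr r (by simpa using hr))
    have h3 : volume.real (r +ᵥ A) = a := by rw [Measure.real, hvadd]
    rw [hA', Set.inter_comm]
    linarith
  have hint : ∀ S : Set E3, IsCompact S → IntegrableOn d S := fun S hS =>
    hdc.continuousOn.integrableOn_compact hS
  -- The constant 8 comes from `(2 (x + y))² ≤ 8 x² + 8 y²`.
  have hpt : ∀ s ∈ A', d r ≤ 8 * d s + 8 * d (s - r) := by
    rintro s ⟨hs, hs'⟩
    have ht : s - r ∈ A := by
      rw [Set.mem_vadd_set_iff_neg_vadd_mem, vadd_eq_add] at hs'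
      rwa [sub_eq_neg_add]
    have h := norm_expMag_sub_add_le B s (s - r) ψ (by
      refine le_trans ?_ (hb s hs _ ht)
      gcongr)
    rw [sub_sub_cancel] at h
    simp only [hd]
    nlinarith [norm_nonneg (expMag B ((2 : ℝ) • r) ψ - ψ), sq_nonneg
      (‖expMag B ((2 : ℝ) • s) ψ - ψ‖ - ‖expMag B ((2 : ℝ) • (s - r)) ψ - ψ‖)]
  have hA'c : IsCompact A' := hAc.inter_right (hAc.isClosed.vadd r)
  have hshift : Continuous fun s => d (s - r) := hdc.comp (continuous_sub_right r)
  have h1 : volume.real A' * d r ≤ ∫ s in A', (8 * d s + 8 * d (s - r)) := by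
    rw [← smul_eq_mul, ← setIntegral_const]
    exact setIntegral_mono_on (integrableOn_const hA'c.measure_lt_top.ne)
      (((hdc.const_mul 8).add (hshift.const_mul 8)).continuousOn.integrableOn_compact hA'c) hA'm hpt
  have h2 : ∫ s in A', d s ≤ ∫ s in A, d s :=
    setIntegral_mono_set (hint A hAc) (Eventually.of_forall hd0)
      (Set.inter_subset_left).eventuallyLE
  have h3 : ∫ s in A', d (s - r) ≤ ∫ s in A, d s := by
    have e : ∫ s in (r +ᵥ A), d (s - r) = ∫ s in A, d s := by
      have := (measurePreserving_add_left (volume : Measure E3) r).setIntegral_image_emb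
        (measurableEmbedding_addLeft r) (fun s => d (s - r)) A
      simpa [← Set.image_vadd] using this
    rw [← e]
    exact setIntegral_mono_set (hshift.continuousOn.integrableOn_compact (hAc.vadd r))
      (Eventually.of_forall fun s => hd0 _) (Set.inter_subset_right).eventuallyLE
  rw [integral_add ((hdc.const_mul 8).continuousOn.integrableOn_compact hA'c)
    ((hshift.const_mul 8).continuousOn.integrableOn_compact hA'c), integral_const_mul,
    integral_const_mul] at h1
  have h4 := setIntegral_le_meanDisplacement B φ ψ hAc hε hφA
  -- Each of the two terms integrates over `A'` to at most `8 ∫_A d`, whence `16` here and `32 / a`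
  -- in the final constant.
  have h5 : a / 2 * d r ≤ 16 * (ε⁻¹ * meanDisplacement B φ ψ) := by
    have := mul_le_mul_of_nonneg_right hA'v (hd0 r)
    simp only [hd] at *
    linarith
  have e : 32 / a * ε⁻¹ * meanDisplacement B φ ψ =
    (a / 2)⁻¹ * (16 * (ε⁻¹ * meanDisplacement B φ ψ)) := by field_simp; ring
  rw [e, ← div_eq_inv_mul, le_div_iff₀ (by positivity)]
  linarith

end Steinhaus

/-! ### Test functions -/

lemma contDiff_bwedge_apply (B : ℝ) (j : Fin 3) :
    ContDiff ℝ ∞ fun X : E3 => ((bwedge B X j : ℝ) : ℂ) := by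
  refine Complex.ofRealCLM.contDiff.comp ?_
  have h0 : ContDiff ℝ ∞ fun X : E3 => X 0 := contDiff_piLp_apply 2
  have h1 : ContDiff ℝ ∞ fun X : E3 => X 1 := contDiff_piLp_apply 2
  fin_cases j
  · exact (contDiff_const.mul h1).neg
  · exact contDiff_const.mul h0
  · exact contDiff_const

lemma isTestFunction_magMomentum (B : ℝ) (j : Fin 3) {f : E3 → ℂ} (hf : IsTestFunction f) :
    IsTestFunction (magMomentum B j f) := by
  refine ⟨?_, ?_⟩
  · have h1 : ContDiff ℝ ∞ fun X => fderiv ℝ f X (EuclideanSpace.single j 1) :=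
      (hf.1.fderiv_right (m := ∞) (by simp)).clm_apply contDiff_const
    exact (contDiff_const.mul h1).add ((contDiff_bwedge_apply B j).mul hf.1)
  · have h1 : HasCompactSupport fun X => fderiv ℝ f X (EuclideanSpace.single j 1) :=
      hf.2.fderiv_apply ℝ _
    exact (h1.mul_left (f := fun _ => -Complex.I)).add hf.2.mul_left

lemma IsTestFunction.memLp {f : E3 → ℂ} (hf : IsTestFunction f) : MemLp f 2 volume :=
  hf.1.continuous.memLp_of_hasCompactSupport hf.2

lemma IsTestFunction.add {f g : E3 → ℂ} (hf : IsTestFunction f) (hg : IsTestFunction g) :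
    IsTestFunction (f + g) := ⟨hf.1.add hg.1, hf.2.add hg.2⟩

lemma IsTestFunction.differentiable {f : E3 → ℂ} (hf : IsTestFunction f) :
    Differentiable ℝ f := hf.1.differentiable (by simp)

/-- The space of test functions. -/
def testSpace : Submodule ℂ (E3 → ℂ) where
  carrier := {f | IsTestFunction f}
  add_mem' := IsTestFunction.add
  zero_mem' := ⟨contDiff_const, HasCompactSupport.zero⟩
  smul_mem' := fun c _ hf => ⟨contDiff_const.smul hf.1, hf.2.smul_left (f := fun _ => c)⟩

/-- The `L²` class of a test function. -/
def testToL2 : testSpace →ₗ[ℂ] L2 where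
  toFun f := (IsTestFunction.memLp f.2).toLp f.1
  map_add' f g := MemLp.toLp_add (IsTestFunction.memLp f.2) (IsTestFunction.memLp g.2)
  map_smul' c f := MemLp.toLp_const_smul c (IsTestFunction.memLp f.2)

lemma testToL2_coeFn (f : testSpace) : testToL2 f =ᵐ[volume] f.1 :=
  (IsTestFunction.memLp f.2).coeFn_toLp

/-- A component of the magnetic momentum, acting on test functions. -/
def magTest (B : ℝ) (j : Fin 3) : testSpace →ₗ[ℂ] testSpace where
  toFun f := ⟨magMomentum B j f.1, isTestFunction_magMomentum B j f.2⟩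
  map_add' f g := by
    ext X
    have hf := IsTestFunction.differentiable f.2
    have hg := IsTestFunction.differentiable g.2
    simp only [magMomentum, Submodule.coe_add, Pi.add_apply, fderiv_add (hf X) (hg X), add_apply]
    ring
  map_smul' c f := by
    ext X
    have hf := IsTestFunction.differentiable f.2
    simp only [magMomentum, Submodule.coe_smul, Pi.smul_apply, fderiv_const_smul (hf X) c,
      smul_apply, smul_eq_mul, RingHom.id_apply]
    ring

lemma dense_range_testToL2 : DenseRange testToL2 := by
  refine (Lp.dense_hasCompactSupport_contDiff (p := 2) (F := ℂ) (μ := (volume : Measure E3))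
    ENNReal.ofNat_ne_top).mono ?_
  rintro f ⟨g, hfg, hg1, hg2⟩
  exact ⟨⟨g, hg2, hg1⟩, Lp.ext ((testToL2_coeFn _).trans hfg.symm)⟩

lemma inner_testToL2 (f : testSpace) (u : L2) :
    inner ℂ (testToL2 f) u = ∫ X, star (f.1 X) * u X := by
  rw [L2.inner_def]
  refine integral_congr_ae ?_
  filter_upwards [testToL2_coeFn f] with X hX
  rw [hX, RCLike.inner_apply, mul_comm]
  rfl

/-- The components of the magnetic momentum are symmetric on test functions. -/
lemma inner_magTest (B : ℝ) (j : Fin 3) (f g : testSpace) :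
    inner ℂ (testToL2 (magTest B j f)) (testToL2 g) =
      inner ℂ (testToL2 f) (testToL2 (magTest B j g)) := by
  have hI : ∀ a b : testSpace, inner ℂ (testToL2 a) (testToL2 b) = ∫ X, star (a.1 X) * b.1 X := by
    intro a b
    rw [inner_testToL2]
    refine integral_congr_ae ?_
    filter_upwards [testToL2_coeFn b] with X hX
    rw [hX]
  rw [hI, hI]
  set e : E3 := EuclideanSpace.single j 1
  have hfd := IsTestFunction.differentiable f.2
  have hgd := IsTestFunction.differentiable g.2
  have hfs : ContDiff ℝ ∞ fun X => star (f.1 X) :=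
    (RCLike.conjCLE (K := ℂ)).contDiff.comp f.2.1
  have hfc : HasCompactSupport fun X => star (f.1 X) := f.2.2.comp_left (star_zero ℂ)
  have hfder : ∀ X, HasFDerivAt (fun X => star (f.1 X))
      ((RCLike.conjCLE (K := ℂ) : ℂ →L[ℝ] ℂ).comp (fderiv ℝ f.1 X)) X := fun X =>
    ((RCLike.conjCLE (K := ℂ)).hasFDerivAt).comp X (hfd X).hasFDerivAt
  have hfe : ∀ X, fderiv ℝ (fun X => star (f.1 X)) X e = star (fderiv ℝ f.1 X e) := fun X => by
    rw [(hfder X).fderiv]; rfl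
  have hint : ∀ {a b : E3 → ℂ}, Continuous a → Continuous b → HasCompactSupport b →
      Integrable fun X => a X * b X := fun ha hb hc =>
    (ha.mul hb).integrable_of_hasCompactSupport hc.mul_left
  have cg := (hgd.continuous)
  have cf := hfs.continuous
  have dg : Continuous fun X => fderiv ℝ g.1 X e :=
    ((g.2.1.continuous_fderiv (by simp)).clm_apply continuous_const)
  have df : Continuous fun X => fderiv ℝ (fun X => star (f.1 X)) X e :=
    ((hfs.continuous_fderiv (by simp)).clm_apply continuous_const)
  have i1 := hint df cg g.2.2
  have i2 := hint cf dg (g.2.2.fderiv_apply ℝ e)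
  have i3 := hint cf cg g.2.2
  -- The sign from the integration by parts cancels against the conjugation of `-i`; the potential
  -- part is multiplication by a real function.
  have ibp := integral_mul_fderiv_eq_neg_fderiv_mul_of_integrable i1 i2 i3
    (fun X _ => hfs.differentiable (by simp) X) (fun X _ => hgd X)
  have cb := (contDiff_bwedge_apply B j).continuous
  have i4 : Integrable fun X => star (f.1 X) * (((bwedge B X j : ℝ) : ℂ) * g.1 X) :=
    hint cf (cb.mul cg) g.2.2.mul_left
  have e1 : ∀ X, star ((magTest B j f).1 X) * g.1 X =
      Complex.I * (fderiv ℝ (fun X => star (f.1 X)) X e * g.1 X) +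
        star (f.1 X) * (((bwedge B X j : ℝ) : ℂ) * g.1 X) := fun X => by
    rw [hfe]
    simp only [magTest, LinearMap.coe_mk, AddHom.coe_mk, magMomentum, star_add, star_mul', star_neg,
      Complex.star_def, Complex.conj_I, Complex.conj_ofReal]
    ring
  have e2 : ∀ X, star (f.1 X) * (magTest B j g).1 X =
      -Complex.I * (star (f.1 X) * fderiv ℝ g.1 X e) +
        star (f.1 X) * (((bwedge B X j : ℝ) : ℂ) * g.1 X) := fun X => by
    simp only [magTest, LinearMap.coe_mk, AddHom.coe_mk, magMomentum]
    ring
  simp only [e1, e2]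
  rw [integral_add (i1.const_mul _) i4, integral_add (i2.const_mul _) i4, integral_const_mul,
    integral_const_mul, ibp]
  ring

/-! ### The Friedrichs extension -/

/-- The Hilbert space `L² × (L²)³`, which contains the graph of the magnetic momentum. -/
abbrev GraphSpace : Type := WithLp 2 (L2 × PiLp 2 fun _ : Fin 3 => L2)

/-- The graph of the magnetic momentum on test functions. -/
def magGraph (B : ℝ) : testSpace →ₗ[ℂ] GraphSpace where
  toFun f := WithLp.toLp 2 (testToL2 f, WithLp.toLp 2 fun j => testToL2 (magTest B j f))
  map_add' f g := by simp only [map_add]; rfl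
  map_smul' c f := by simp only [map_smul]; rfl

/-- The closure of the graph of the magnetic momentum on test functions. -/
def magGraphClosure (B : ℝ) : Submodule ℂ GraphSpace :=
  (LinearMap.range (magGraph B)).topologicalClosure

instance (B : ℝ) : CompleteSpace (magGraphClosure B) :=
  (Submodule.isClosed_topologicalClosure _).completeSpace_coe

lemma magGraph_mem (B : ℝ) (f : testSpace) : magGraph B f ∈ magGraphClosure B :=
  Submodule.le_topologicalClosure _ ⟨f, rfl⟩

lemma exists_seq_magGraph (B : ℝ) {w : GraphSpace} (hw : w ∈ magGraphClosure B) :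
    ∃ s : ℕ → testSpace, Tendsto (fun n => testToL2 (s n)) atTop (𝓝 w.fst) ∧
      ∀ j, Tendsto (fun n => testToL2 (magTest B j (s n))) atTop (𝓝 (w.snd j)) := by
  obtain ⟨x, hx, hlim⟩ := mem_closure_iff_seq_limit.mp hw
  choose s hs using hx
  refine ⟨s, ?_, fun j => ?_⟩
  · have := ((WithLp.fstL 2 ℂ L2 (PiLp 2 fun _ : Fin 3 => L2)).continuous.tendsto w).comp hlim
    refine this.congr fun n => ?_
    simp only [Function.comp_apply, ← hs]
    rfl
  · have h1 := ((WithLp.sndL 2 ℂ L2 (PiLp 2 fun _ : Fin 3 => L2)).continuous.tendsto w).comp hlim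
    have h2 := ((PiLp.proj 2 (𝕜 := ℂ) (fun _ : Fin 3 => L2) j).continuous.tendsto _).comp h1
    refine h2.congr fun n => ?_
    simp only [Function.comp_apply, ← hs]
    rfl

lemma eLpNorm_sub_testToL2 (f : testSpace) (u : L2) :
    eLpNorm (f.1 - ⇑u) 2 volume = edist (testToL2 f) u := by
  rw [Lp.edist_def]
  refine eLpNorm_congr_ae ?_
  filter_upwards [testToL2_coeFn f] with X hX
  simp [hX]

/-- A sequence of graph points converging to `w` has convergent, hence Cauchy, momenta. -/
lemma memFormDomain_of_mem_magGraphClosure (B : ℝ) {w : GraphSpace} (hw : w ∈ magGraphClosure B) :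
    MemFormDomain B w.fst := by
  obtain ⟨s, h0, h1⟩ := exists_seq_magGraph B hw
  refine ⟨fun n => (s n).1, fun n => (s n).2, ?_, fun j => ?_⟩
  · simp only [eLpNorm_sub_testToL2]
    exact tendsto_iff_edist_tendsto_0.mp h0
  · have e : ∀ q : ℕ × ℕ, eLpNorm (magMomentum B j ((s q.1).1 - (s q.2).1)) 2 volume =
        edist (testToL2 (magTest B j (s q.1))) (testToL2 (magTest B j (s q.2))) := fun q => by
      rw [edist_eq_enorm_sub, ← map_sub, ← map_sub, Lp.enorm_def]
      exact (eLpNorm_congr_ae (testToL2_coeFn (magTest B j (s q.1 - s q.2)))).symm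
    simp only [e]
    have h2 : Tendsto (fun q : ℕ × ℕ => testToL2 (magTest B j (s q.1))) (atTop ×ˢ atTop)
      (𝓝 (w.snd j)) := (h1 j).comp tendsto_fst
    have h3 : Tendsto (fun q : ℕ × ℕ => testToL2 (magTest B j (s q.2))) (atTop ×ˢ atTop)
      (𝓝 (w.snd j)) := (h1 j).comp tendsto_snd
    rw [← edist_self (w.snd j)]
    exact h2.edist h3

/-! ### The variational principle on a closed graph -/

section Abstract

variable {H K : Type*} [NormedAddCommGroup H] [InnerProductSpace ℂ H] [CompleteSpace H]
  [NormedAddCommGroup K] [InnerProductSpace ℂ K]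

/-- For a complete subspace `G` of `H × K` (for instance the closed graph of an operator `A`), the
operator `1 - J J*` with the projection `J : G → H` (that is, `A*A (1 + A*A)⁻¹`) and its
variational principle. -/
lemma exists_graph_ratio (G : Submodule ℂ (WithLp 2 (H × K))) [CompleteSpace G] :
    ∃ S : H →L[ℂ] H, (∀ f g, inner ℂ (S f) g = inner ℂ f (S g)) ∧
      (∀ ψ, ∃ w ∈ G, w.fst + S ψ = ψ ∧ ∀ g ∈ G, inner ℂ g.fst ψ = inner ℂ g w) ∧
      ∀ ψ, ∀ g ∈ G, (inner ℂ (S ψ) ψ).re ≤ ‖ψ - g.fst‖ ^ 2 + ‖g.snd‖ ^ 2 := by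
  set J : G →L[ℂ] H := WithLp.fstL 2 ℂ H K ∘L G.subtypeL with hJ
  have hS : ∀ ψ, (1 - J ∘L ContinuousLinearMap.adjoint J) ψ =
    ψ - J (ContinuousLinearMap.adjoint J ψ) := fun ψ => rfl
  refine ⟨1 - J ∘L ContinuousLinearMap.adjoint J, fun f g => ?_, fun ψ => ?_, fun ψ g hg => ?_⟩
  · rw [hS, hS, inner_sub_left, inner_sub_right, ← ContinuousLinearMap.adjoint_inner_right J,
      ← ContinuousLinearMap.adjoint_inner_left J]
  · refine ⟨(ContinuousLinearMap.adjoint J ψ).1, (ContinuousLinearMap.adjoint J ψ).2, ?_,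
      fun g hg => ?_⟩
    · rw [hS]
      exact add_sub_cancel _ _
    · exact (ContinuousLinearMap.adjoint_inner_right J ⟨g, hg⟩ ψ).symm
  · set a := ContinuousLinearMap.adjoint J ψ with ha
    have h1 : (inner ℂ (ψ - J a) ψ).re = ‖ψ‖ ^ 2 - ‖a‖ ^ 2 := by
      rw [inner_sub_left, ← ContinuousLinearMap.adjoint_inner_right, Complex.sub_re]
      have e1 := inner_self_eq_norm_sq (𝕜 := ℂ) ψ
      have e2 := inner_self_eq_norm_sq (𝕜 := ℂ) a
      simp only [RCLike.re_to_complex] at e1 e2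
      rw [← e1, ← e2]
    have h2 := norm_sub_sq (𝕜 := ℂ) a ⟨g, hg⟩
    have h3 := norm_sub_sq (𝕜 := ℂ) ψ g.fst
    have h4 : inner ℂ a ⟨g, hg⟩ = inner ℂ ψ g.fst :=
      ContinuousLinearMap.adjoint_inner_left J ⟨g, hg⟩ ψ
    have h5 : ‖(⟨g, hg⟩ : G)‖ ^ 2 = ‖g.fst‖ ^ 2 + ‖g.snd‖ ^ 2 := by
      rw [Submodule.coe_norm, WithLp.prod_norm_sq_eq_of_L2]
    rw [h4] at h2
    -- Completing the square: the gap in the claimed inequality is exactly `‖a - g‖²`, computed in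
    -- `G`.
    have h6 := sq_nonneg ‖a - ⟨g, hg⟩‖
    rw [hS, h1]
    linarith

end Abstract

/-- Existence of the bounded operator `Π² (1 + Π²)⁻¹`, and the variational principle for its
quadratic form. -/
lemma exists_isMagRatio (B : ℝ) : ∃ S : L2 →L[ℂ] L2, IsMagRatio B 1 S ∧
    (∀ f g, inner ℂ (S f) g = inner ℂ f (S g)) ∧
    ∀ ψ, ∀ g ∈ magGraphClosure B,
      (inner ℂ (S ψ) ψ).re ≤ ‖ψ - g.fst‖ ^ 2 + ∑ j, ‖g.snd j‖ ^ 2 := by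
  obtain ⟨S, hsymm, hS, hvar⟩ := exists_graph_ratio (magGraphClosure B)
  refine ⟨S, fun ψ => ?_, hsymm, fun ψ g hg => ?_⟩
  · obtain ⟨w, hwG, hw1, hw2⟩ := hS ψ
    refine ⟨w.fst, ⟨memFormDomain_of_mem_magGraphClosure B hwG, fun v hv => ?_⟩, ?_⟩
    · set v' : testSpace := ⟨v, hv⟩ with hv'
      set Lv : testSpace := ∑ j, magTest B j (magTest B j v') with hLv
      have e1 : ∫ X, star (v X) * (S ψ) X = inner ℂ (testToL2 v') (S ψ) :=
        (inner_testToL2 v' _).symm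
      have e2 : ∫ X, star (magLaplacian B v X) * w.fst X = inner ℂ (testToL2 Lv) w.fst := by
        rw [inner_testToL2]
        congr 1
      have h1 : inner ℂ (testToL2 v') ψ = inner ℂ (magGraph B v') w :=
        hw2 _ (magGraph_mem B v')
      have h2 : inner ℂ (magGraph B v') w = inner ℂ (testToL2 v') w.fst +
          ∑ j, inner ℂ (testToL2 (magTest B j v')) (w.snd j) := by
        rw [WithLp.prod_inner_apply, PiLp.inner_apply]; rfl
      obtain ⟨s, hs0, hs1⟩ := exists_seq_magGraph B hwG
      -- The relation `w.snd j = Π_j w.fst` holds weakly: symmetry of `Π_j` on test functions passes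
      -- to the limit along the approximating sequence.
      have h4 : ∀ j, inner ℂ (testToL2 (magTest B j v')) (w.snd j) =
          inner ℂ (testToL2 (magTest B j (magTest B j v'))) w.fst := fun j => by
        have t1 := (tendsto_const_nhds (x := testToL2 (magTest B j v'))).inner (𝕜 := ℂ) (hs1 j)
        have t2 := (tendsto_const_nhds
          (x := testToL2 (magTest B j (magTest B j v')))).inner (𝕜 := ℂ) hs0
        simp only [← inner_magTest] at t1
        exact tendsto_nhds_unique t1 t2
      have h5 : inner ℂ (testToL2 v') ψ =
          inner ℂ (testToL2 v') w.fst + inner ℂ (testToL2 v') (S ψ) := by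
        rw [← inner_add_right, hw1]
      rw [e1, e2, hLv, map_sum, sum_inner]
      simp only [← h4]
      rw [h1, h2] at h5
      exact add_left_cancel h5
    · rw [Complex.ofReal_one, one_smul, hw1]
  · refine (hvar ψ g hg).trans (le_of_eq ?_)
    rw [PiLp.norm_sq_eq_of_L2]

/-! ### Magnetic translations of test functions -/

lemma inner_bwedge_single (B : ℝ) (r : E3) (j : Fin 3) :
    inner ℝ r (bwedge B (EuclideanSpace.single j 1)) = -bwedge B r j := by
  rw [inner_bwedge_comm, EuclideanSpace.inner_single_left]; simp

lemma isTestFunction_magTranslate (B : ℝ) (r : E3) {f : E3 → ℂ} (hf : IsTestFunction f) :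
    IsTestFunction (magTranslate B r f) := by
  refine ⟨?_, ?_⟩
  · have h1 : ContDiff ℝ ∞ fun X : E3 => -(inner ℝ X (bwedge B r)) :=
      (contDiff_id.inner ℝ contDiff_const).neg
    have h2 : ContDiff ℝ ∞ (magPhase B r) := by
      unfold magPhase
      -- Antisymmetry turns the exponent into an inner product of `X` with a fixed vector, which is
      -- visibly smooth.
      simp only [inner_bwedge_comm B r]
      exact (contDiff_const.mul (Complex.ofRealCLM.contDiff.comp h1)).cexp
    exact h2.mul (hf.1.comp (contDiff_id.add contDiff_const))
  · exact (hf.2.comp_homeomorph (Homeomorph.addRight r)).mul_left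

/-- The magnetic translation on test functions. -/
def translateTest (B : ℝ) (r : E3) (f : testSpace) : testSpace :=
  ⟨magTranslate B r f.1, isTestFunction_magTranslate B r f.2⟩

lemma testToL2_translateTest (B : ℝ) (r : E3) (f : testSpace) :
    testToL2 (translateTest B r f) = expMag B r (testToL2 f) := by
  apply Lp.ext
  have h2 := (measurePreserving_add_right volume r).quasiMeasurePreserving.ae_eq_comp
    (testToL2_coeFn f)
  filter_upwards [testToL2_coeFn (translateTest B r f), expMag_coeFn B r (testToL2 f), h2]
    with X h1 h2 h3
  simp only [Function.comp_apply] at h3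
  rw [h1, h2, magTranslate, h3]
  rfl

/-- The commutation relation between the magnetic momentum and the magnetic translations. -/
lemma magTest_translateTest (B : ℝ) (j : Fin 3) (r : E3) (f : testSpace) :
    magTest B j (translateTest B r f) =
      translateTest B r (magTest B j f) - ((2 * bwedge B r j : ℝ) : ℂ) • translateTest B r f := by
  ext X
  set e : E3 := EuclideanSpace.single j 1 with he
  have hfd := IsTestFunction.differentiable f.2
  -- The same line derivative is computed by the product rule in `h2`, where differentiating the
  -- phase contributes one `-(𝐁 ∧ r)_j`; a second one comes from the potential at `X` instead of `X
  -- + r`. This explains the factor 2.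
  have h1 := (IsTestFunction.differentiable (translateTest B r f).2 X).hasFDerivAt.hasLineDerivAt e
  have h2 : HasLineDerivAt ℝ (translateTest B r f).1
      (magPhase B r X * (Complex.I * (-bwedge B r j : ℝ)) * f.1 (X + r) +
        magPhase B r X * fderiv ℝ f.1 (X + r) e) X e := by
    have p1 : HasDerivAt (fun t : ℝ => magPhase B r (X + t • e))
        (magPhase B r X * (Complex.I * (-bwedge B r j : ℝ))) 0 := by
      have e1 : (fun t : ℝ => magPhase B r (X + t • e)) = fun t : ℝ =>
          magPhase B r X * Complex.exp ((t : ℂ) * (Complex.I * (-bwedge B r j : ℝ))) := by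
        funext t
        simp only [magPhase]
        rw [← Complex.exp_add, bwedge_add, bwedge_smul, inner_add_right, inner_smul_right,
          he, inner_bwedge_single]
        congr 1
        push_cast; ring
      rw [e1]
      have := (((Complex.ofRealCLM.hasDerivAt (x := 0)).mul_const
        (Complex.I * ((-bwedge B r j : ℝ) : ℂ))).cexp).const_mul (magPhase B r X)
      simpa using this
    have p2 : HasDerivAt (fun t : ℝ => f.1 (X + t • e + r)) (fderiv ℝ f.1 (X + r) e) 0 := by
      have hl : HasDerivAt (fun t : ℝ => X + t • e + r) e 0 := by
        simpa using (((hasDerivAt_id (0 : ℝ)).smul_const e).const_add X).add_const r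
      exact ((hfd (X + (0 : ℝ) • e + r)).hasFDerivAt.comp_hasDerivAt 0 hl).congr_deriv (by simp)
    exact (p1.mul p2).congr_deriv (by simp)
  have h3 := h1.unique h2
  have hb : bwedge B (X + r) j = bwedge B X j + bwedge B r j := by rw [bwedge_add]; rfl
  simp only [magTest, LinearMap.coe_mk, AddHom.coe_mk, magMomentum, Submodule.coe_sub,
    Submodule.coe_smul, Pi.sub_apply, Pi.smul_apply, smul_eq_mul, ← he]
  rw [h3]
  simp only [translateTest, magTranslate]
  rw [magMomentum, hb, ← he]
  push_cast
  linear_combination (magPhase B r X * bwedge B r j * f.1 (X + r)) * Complex.I_sq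

/-- The commutation relation reduces this to strong continuity of `r ↦ T_r` on two fixed vectors. It
makes the mollification integrable in the graph norm. -/
lemma continuous_testToL2_magTest_translateTest (B : ℝ) (j : Fin 3) (f : testSpace) :
    Continuous fun r => testToL2 (magTest B j (translateTest B r f)) := by
  simp only [magTest_translateTest, map_sub, map_smul, testToL2_translateTest]
  have h1 := continuous_expMag B (testToL2 (magTest B j f))
  have h2 := continuous_expMag B (testToL2 f)
  have h3 : Continuous fun r : E3 => ((2 * bwedge B r j : ℝ) : ℂ) := by
    have := (contDiff_bwedge_apply B j).continuous
    simp only [Complex.ofReal_mul]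
    exact continuous_const.mul this
  exact h1.sub (h3.smul h2)

/-- The derivative of `t ↦ e^{i t Π_j} f` at `t = 0`. -/
lemma hasDerivAt_expMag_smul_single (B : ℝ) (j : Fin 3) (f : testSpace) :
    HasDerivAt (fun t : ℝ => expMag B (t • EuclideanSpace.single j 1) (testToL2 f))
      (Complex.I • testToL2 (magTest B j f)) 0 := by
  rw [hasDerivAt_iff_tendsto_slope, tendsto_iff_edist_tendsto_0]
  refine (tendsto_magTranslate B (EuclideanSpace.single j 1) f.1 f.2).congr fun t => ?_
  set e : E3 := EuclideanSpace.single j 1 with he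
  have hs : slope (fun t : ℝ => expMag B (t • e) (testToL2 f)) 0 t =
      testToL2 ((t : ℂ)⁻¹ • (translateTest B (t • e) f - f)) := by
    rw [slope, map_smul, map_sub, testToL2_translateTest]
    simp only [vsub_eq_sub, sub_zero, zero_smul, expMag_zero]
    rw [← Complex.ofReal_inv, Complex.coe_smul]
    rfl
  rw [hs, ← map_smul, edist_eq_enorm_sub, ← map_sub, Lp.enorm_def]
  refine eLpNorm_congr_ae (EventuallyEq.symm ((testToL2_coeFn _).trans
    (Eventually.of_forall fun X => ?_)))
  simp [translateTest, magTest, he, PiLp.single_apply, apply_ite]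

/-- The derivative of `r ↦ e^{i r·Π} f`. -/
lemma hasLineDerivAt_expMag (B : ℝ) (j : Fin 3) (f : testSpace) (r : E3) :
    HasLineDerivAt ℝ (fun r => expMag B r (testToL2 f))
      (Complex.I • (testToL2 (magTest B j (translateTest B r f)) +
        ((bwedge B r j : ℝ) : ℂ) • expMag B r (testToL2 f))) r (EuclideanSpace.single j 1) := by
  set e : E3 := EuclideanSpace.single j 1 with he
  -- The derivative at a general point reduces to the one at the origin, since the Weyl relation
  -- gives `T_{r + t e} = e^{i t (𝐁 ∧ r)_j} T_{t e} T_r`.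
  have h1 := hasDerivAt_expMag_smul_single B j (translateTest B r f)
  have h2 : HasDerivAt (fun t : ℝ => Complex.exp ((t : ℂ) * (Complex.I * (bwedge B r j : ℝ))))
      (Complex.I * (bwedge B r j : ℝ)) 0 := by
    have := ((Complex.ofRealCLM.hasDerivAt (x := 0)).mul_const
        (Complex.I * ((bwedge B r j : ℝ) : ℂ))).cexp
    simpa using this
  have h3 := h2.smul h1
  unfold HasLineDerivAt
  refine (h3.congr_deriv ?_).congr_of_eventuallyEq (Eventually.of_forall fun t => ?_)
  · simp only [zero_smul, expMag_zero, testToL2_translateTest, Complex.ofReal_zero, zero_mul,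
      Complex.exp_zero, one_mul, smul_add, smul_smul]
  · simp only [testToL2_translateTest, Pi.smul_apply']
    rw [expMag_comp, bwedge_smul, inner_smul_right, he, inner_bwedge_single, smul_smul,
      ← Complex.exp_add, add_comm (t • _) r]
    rw [show (t : ℂ) * (Complex.I * (bwedge B r j : ℝ)) + Complex.I * (t * -bwedge B r j : ℝ) = 0 by
      push_cast; ring]
    simp

/-! ### Mollification along magnetic translations -/

/-- A smooth even probability density supported in the ball of radius `δ`. -/
structure IsMollifier (δ : ℝ) (h : E3 → ℝ) : Prop where
  contDiff : ContDiff ℝ ∞ h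
  tsupport_subset : tsupport h ⊆ Metric.closedBall 0 δ
  nonneg : ∀ r, 0 ≤ h r
  even : ∀ r, h (-r) = h r
  integral_eq_one : ∫ r, h r = 1

lemma exists_isMollifier {δ : ℝ} (hδ : 0 < δ) : ∃ h : E3 → ℝ, IsMollifier δ h := by
  let η : ContDiffBump (0 : E3) := ⟨δ / 2, δ, by positivity, by linarith⟩
  exact ⟨η.normed volume, η.contDiff_normed, η.tsupport_normed_eq.subset,
    fun r => η.nonneg_normed r, fun r => η.normed_neg r, η.integral_normed⟩

variable {δ : ℝ} {h : E3 → ℝ}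

lemma IsMollifier.hasCompactSupport (hh : IsMollifier δ h) : HasCompactSupport h :=
  (isCompact_closedBall 0 δ).of_isClosed_subset (isClosed_tsupport h) hh.tsupport_subset

lemma IsMollifier.integrable_smul {H : Type*} [NormedAddCommGroup H] [NormedSpace ℝ H]
    (hh : IsMollifier δ h) {F : E3 → H} (hF : Continuous F) :
    Integrable fun r => h r • F r :=
  (hh.contDiff.continuous.smul hF).integrable_of_hasCompactSupport hh.hasCompactSupport.smul_right

lemma IsMollifier.integrable (hh : IsMollifier δ h) : Integrable h :=
  hh.contDiff.continuous.integrable_of_hasCompactSupport hh.hasCompactSupport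

/-- The integral of a function that is bounded on the ball of radius `δ`, against a function
supported in this ball. -/
lemma norm_integral_smul_le {H : Type*} [NormedAddCommGroup H] [NormedSpace ℝ H] {k : E3 → ℝ}
    (hk : Integrable k) (hks : ∀ r, ¬ ‖r‖ ≤ δ → k r = 0) {F : E3 → H} {M : ℝ}
    (hF : ∀ r, ‖r‖ ≤ δ → ‖F r‖ ≤ M) : ‖∫ r, k r • F r‖ ≤ (∫ r, |k r|) * M := by
  rw [← integral_mul_const]
  refine norm_integral_le_of_norm_le (hk.abs.mul_const M) (Eventually.of_forall fun r => ?_)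
  rw [norm_smul, Real.norm_eq_abs]
  by_cases hr : ‖r‖ ≤ δ
  · exact mul_le_mul_of_nonneg_left (hF r hr) (abs_nonneg _)
  · simp [hks r hr]

lemma IsMollifier.eq_zero (hh : IsMollifier δ h) {r : E3} (hr : ¬ ‖r‖ ≤ δ) : h r = 0 :=
  image_eq_zero_of_notMem_tsupport fun hm => hr (by simpa using hh.tsupport_subset hm)

lemma IsMollifier.fderiv_eq_zero (hh : IsMollifier δ h) {r : E3} (hr : ¬ ‖r‖ ≤ δ) :
    fderiv ℝ h r = 0 :=
  image_eq_zero_of_notMem_tsupport fun hm =>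
    hr (by simpa using hh.tsupport_subset (tsupport_fderiv_subset ℝ hm))

/-- As `h` has mass one, the difference is itself an `h`-average of the vectors `v - F r`. -/
lemma IsMollifier.norm_integral_smul_sub_le {H : Type*} [NormedAddCommGroup H] [NormedSpace ℝ H]
    [CompleteSpace H] (hh : IsMollifier δ h) {F : E3 → H} (hF : Continuous F) {v : H} {M : ℝ}
    (hM : ∀ r, ‖r‖ ≤ δ → ‖F r - v‖ ≤ M) : ‖v - ∫ r, h r • F r‖ ≤ M := by
  have e : v - ∫ r, h r • F r = -∫ r, h r • (F r - v) := by
    simp only [smul_sub]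
    rw [integral_sub (hh.integrable_smul hF) (hh.integrable.smul_const v), integral_smul_const,
      hh.integral_eq_one, one_smul, neg_sub]
  rw [e, norm_neg]
  refine (norm_integral_smul_le hh.integrable (fun r hr => hh.eq_zero hr) hM).trans (le_of_eq ?_)
  simp only [abs_of_nonneg (hh.nonneg _), hh.integral_eq_one, one_mul]

lemma abs_bwedge_apply_le (B : ℝ) (r : E3) (j : Fin 3) : |bwedge B r j| ≤ |B| * ‖r‖ :=
  (PiLp.norm_apply_le (bwedge B r) j).trans (norm_bwedge_le B r)

/-- Up to the term `(𝐁 ∧ r)_j T_r f`, the integrand `Π_j T_r f` is `-i ∂_j (T_r f)`, and the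
derivative can be moved to `h`. The point is to have only the displacement `T_r f - f` left on the
right, not `f` itself. -/
lemma IsMollifier.norm_integral_magTest_le (hh : IsMollifier δ h) (B : ℝ) (j : Fin 3)
    (f : testSpace) {M : ℝ} (hM0 : 0 ≤ M)
    (hM : ∀ r, ‖r‖ ≤ δ → ‖expMag B r (testToL2 f) - testToL2 f‖ ≤ M) :
    ‖∫ r, h r • testToL2 (magTest B j (translateTest B r f))‖ ≤
      ((∫ r, |fderiv ℝ h r (EuclideanSpace.single j 1)|) + |B| * δ) * M := by
  set e : E3 := EuclideanSpace.single j 1 with he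
  set F : E3 → L2 := fun r => expMag B r (testToL2 f) - testToL2 f with hF
  set b : E3 → ℝ := fun r => bwedge B r j with hb
  have hFc : Continuous F := (continuous_expMag B _).sub continuous_const
  have hbc : Continuous b := by
    have := continuous_bwedge B
    simp only [hb]
    fun_prop
  have hmc := continuous_testToL2_magTest_translateTest B j f
  set D : E3 → L2 := fun r => Complex.I • (testToL2 (magTest B j (translateTest B r f)) +
        ((bwedge B r j : ℝ) : ℂ) • expMag B r (testToL2 f)) with hD
  have hbcc : Continuous fun r => ((bwedge B r j : ℝ) : ℂ) := Complex.continuous_ofReal.comp hbc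
  have hDc : Continuous D :=
    (hmc.add (hbcc.smul (continuous_expMag B (testToL2 f)))).const_smul Complex.I
  have hFD : ∀ r, HasLineDerivAt ℝ F (D r) r e := fun r => by
    have := hasLineDerivAt_expMag B j f r
    unfold HasLineDerivAt at this ⊢
    exact this.sub_const _
  have hhd : ∀ r, HasLineDerivAt ℝ h (fderiv ℝ h r e) r e := fun r =>
    ((hh.contDiff.differentiable (by simp)) r).hasFDerivAt.hasLineDerivAt e
  have hdc : Continuous fun r => fderiv ℝ h r e :=
    (hh.contDiff.continuous_fderiv (by simp)).clm_apply continuous_const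
  have hds : HasCompactSupport fun r => fderiv ℝ h r e := hh.hasCompactSupport.fderiv_apply ℝ e
  have ibp : ∫ r, h r • D r = -∫ r, fderiv ℝ h r e • F r :=
    integral_bilinear_hasLineDerivAt_right_eq_neg_left_of_integrable
      (B := ContinuousLinearMap.lsmul ℝ ℝ)
      ((hdc.smul hFc).integrable_of_hasCompactSupport hds.smul_right)
      (hh.integrable_smul hDc) (hh.integrable_smul hFc) (fun r _ => hhd r) (fun r _ => hFD r)
  have hbi : Integrable fun r => h r * b r := hh.integrable_smul hbc
  -- Replacing `T_r f` by `T_r f - f` is free in the derivative term, and in the magnetic term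
  -- because `h` is even and `b` is odd.
  have hodd : ∫ r, h r * b r = 0 := by
    have h1 := integral_neg_eq_self (fun r => h r * b r) (volume : Measure E3)
    have h2 : ∀ r, h (-r) * b (-r) = -(h r * b r) := fun r => by
      have : b (-r) = - b r := by
        simp only [hb]
        rw [← neg_one_smul ℝ r, bwedge_smul]; simp
      rw [hh.even, this]; ring
    simp only [h2, integral_neg] at h1
    linarith
  have hbF : Integrable fun r => (h r * b r) • F r := by
    refine (hh.integrable_smul (hbc.smul hFc)).congr (Eventually.of_forall fun r => ?_)
    simp [smul_smul]
  have key : ∫ r, h r • testToL2 (magTest B j (translateTest B r f)) =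
      Complex.I • (∫ r, fderiv ℝ h r e • F r) - ∫ r, (h r * b r) • F r := by
    have e1 : ∀ r, h r • testToL2 (magTest B j (translateTest B r f)) =
        ((-Complex.I) • (h r • D r) - (h r * b r) • F r) - (h r * b r) • testToL2 f := fun r => by
      have e2 : (-Complex.I) • (h r • D r) = h r • (testToL2 (magTest B j (translateTest B r f)) +
          b r • expMag B r (testToL2 f)) := by
        simp only [hD, hb]
        rw [smul_comm, smul_smul, neg_mul, Complex.I_mul_I, neg_neg, one_smul, Complex.coe_smul]
        rfl
      rw [e2]
      simp only [hF]
      module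
    simp only [e1]
    have iD : Integrable fun r => (-Complex.I) • (h r • D r) :=
      (hh.integrable_smul hDc).smul (-Complex.I)
    rw [integral_sub (f := fun r => (-Complex.I) • (h r • D r) - (h r * b r) • F r)
      (iD.sub hbF) (hbi.smul_const _), integral_sub iD hbF, integral_smul, ibp,
      integral_smul_const, hodd]
    simp
  rw [key]
  refine (norm_sub_le _ _).trans ?_
  rw [norm_smul, Complex.norm_I, one_mul, add_mul]
  refine add_le_add (norm_integral_smul_le
    (hdc.integrable_of_hasCompactSupport hds) (fun r hr => by rw [hh.fderiv_eq_zero hr]; rfl) hM) ?_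
  refine (norm_integral_smul_le hbi (fun r hr => by rw [hh.eq_zero hr, zero_mul]) hM).trans ?_
  refine mul_le_mul_of_nonneg_right ?_ hM0
  calc ∫ r, |h r * b r| ≤ ∫ r, h r * (|B| * δ) := by
        refine integral_mono hbi.abs (hh.integrable.mul_const _) fun r => ?_
        rw [abs_mul, abs_of_nonneg (hh.nonneg r)]
        by_cases hr : ‖r‖ ≤ δ
        · refine mul_le_mul_of_nonneg_left ((abs_bwedge_apply_le B r j).trans ?_) (hh.nonneg r)
          gcongr
        · simp [hh.eq_zero hr]
    _ = |B| * δ := by rw [integral_mul_const, hh.integral_eq_one, one_mul]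

/-- Mollification along magnetic translations maps into the form domain. -/
lemma exists_mem_magGraphClosure_near {δ : ℝ} (hδ : 0 < δ) (B₀ : ℝ) :
    ∃ C : ℝ, ∀ B, |B| ≤ B₀ → ∀ f : testSpace, ∀ M : ℝ, 0 ≤ M →
      (∀ r, ‖r‖ ≤ δ → ‖expMag B r (testToL2 f) - testToL2 f‖ ≤ M) →
      ∃ w ∈ magGraphClosure B, ‖testToL2 f - w.fst‖ ≤ M ∧ ∀ j, ‖w.snd j‖ ≤ C * M := by
  obtain ⟨h, hh⟩ := exists_isMollifier hδ
  set I : Fin 3 → ℝ := fun j => ∫ r, |fderiv ℝ h r (EuclideanSpace.single j 1)| with hI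
  refine ⟨(∑ j, I j) + B₀ * δ, fun B hB f M hM0 hM => ?_⟩
  -- Integrating inside the complete space `magGraphClosure B` puts the mollified vector in the form
  -- domain at once and identifies its momenta as integrals of momenta.
  set g : E3 → magGraphClosure B := fun r => ⟨magGraph B (translateTest B r f), magGraph_mem B _⟩
    with hg
  have hgc : Continuous g := by
    refine Continuous.subtype_mk ?_ _
    refine (WithLp.prod_continuous_toLp 2 _ _).comp (Continuous.prodMk ?_ ?_)
    · simp only [testToL2_translateTest]
      exact continuous_expMag B _
    · exact (PiLp.continuous_toLp 2 _).comp
        (continuous_pi fun j => continuous_testToL2_magTest_translateTest B j f)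
  set w := ∫ r, h r • g r with hw
  have hint := hh.integrable_smul hgc
  have hw1 : w.1 = ∫ r, h r • magGraph B (translateTest B r f) :=
    ((magGraphClosure B).subtypeL.integral_comp_comm hint).symm
  have hint' : Integrable fun r => h r • magGraph B (translateTest B r f) :=
    (magGraphClosure B).subtypeL.integrable_comp hint
  have hfst : w.1.fst = ∫ r, h r • expMag B r (testToL2 f) := by
    rw [hw1]
    refine ((WithLp.fstL 2 ℂ L2
      (PiLp 2 fun _ : Fin 3 => L2)).integral_comp_comm hint').symm.trans ?_
    congr 1
    funext r
    rw [← testToL2_translateTest]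
    rfl
  have hsnd : ∀ j, w.1.snd j =
      ∫ r, h r • testToL2 (magTest B j (translateTest B r f)) := fun j => by
    rw [hw1]
    exact (((PiLp.proj 2 (𝕜 := ℂ) (fun _ : Fin 3 => L2) j) ∘L
      (WithLp.sndL 2 ℂ L2 (PiLp 2 fun _ : Fin 3 => L2))).integral_comp_comm hint').symm
  refine ⟨w.1, w.2, ?_, fun j => ?_⟩
  · rw [hfst]
    exact hh.norm_integral_smul_sub_le (continuous_expMag B _) hM
  · rw [hsnd]
    refine (hh.norm_integral_magTest_le B j f hM0 hM).trans ?_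
    refine mul_le_mul_of_nonneg_right (add_le_add ?_ (by gcongr)) hM0
    exact Finset.single_le_sum (f := I) (fun i _ => integral_nonneg fun r => abs_nonneg _)
      (Finset.mem_univ j)

/-! ### The lower bound -/

/-- The lower bound on the quadratic form of `1 - R²`, for an arbitrary normalized `φ`. -/
lemma exists_magRatio_form_le (φ : L2) (hφ : ‖φ‖ = 1) (B₀ : ℝ) :
    ∃ c > 0, ∀ B, |B| ≤ B₀ → ∃ S : L2 →L[ℂ] L2, IsMagRatio B 1 S ∧
      (∀ f g, inner ℂ (S f) g = inner ℂ f (S g)) ∧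
      ∀ ψ, c * (inner ℂ (S ψ) ψ).re ≤ ‖ψ‖ ^ 2 - ‖opR B φ ψ‖ ^ 2 := by
  have hφ0 : φ ≠ 0 := by rintro rfl; simp at hφ
  obtain ⟨K, hK, δ, hδ, hdisp⟩ := exists_norm_expMag_sub_sq_le φ hφ0 B₀
  obtain ⟨C, hC⟩ := exists_mem_magGraphClosure_near hδ B₀
  refine ⟨((1 + 3 * C ^ 2) * K * 4)⁻¹, by positivity, fun B hB => ?_⟩
  obtain ⟨S, hS, hsymm, hvar⟩ := exists_isMagRatio B
  refine ⟨S, hS, hsymm, fun ψ => ?_⟩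
  -- Both sides are continuous in `ψ`, and only for test functions is `Π_j T_r f` available.
  refine dense_range_testToL2.induction_on ψ (isClosed_le ?_ ?_) fun f => ?_
  · exact continuous_const.mul (Complex.continuous_re.comp (S.continuous.inner continuous_id))
  · exact (continuous_norm.pow 2).sub ((opR B φ).continuous.norm.pow 2)
  set T := meanDisplacement B φ (testToL2 f) with hT
  have hT0 : 0 ≤ T := integral_nonneg fun s => by positivity
  have hKT : 0 ≤ K * T := by positivity
  -- The displacement bound `√(K T)` enters squared, once for `f - w.fst` and with `C²` for each of
  -- the three momenta; the remaining 4 in the constant is that of `meanDisplacement_le`.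
  obtain ⟨w, hw, h1, h2⟩ := hC B hB f √(K * T) (Real.sqrt_nonneg _) fun r hr =>
    Real.le_sqrt_of_sq_le (hdisp B hB _ r hr)
  have h3 : (inner ℂ (S (testToL2 f)) (testToL2 f)).re ≤ (1 + 3 * C ^ 2) * (K * T) := by
    refine (hvar _ w hw).trans ?_
    have e1 : ‖testToL2 f - w.fst‖ ^ 2 ≤ K * T := by
      rw [← Real.sq_sqrt hKT]; gcongr
    have e2 : ∀ j, ‖w.snd j‖ ^ 2 ≤ C ^ 2 * (K * T) := fun j => by
      rw [← Real.sq_sqrt hKT, ← mul_pow]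
      exact pow_le_pow_left₀ (norm_nonneg _) (h2 j) 2
    have e3 := Finset.sum_le_sum fun j (_ : j ∈ Finset.univ) => e2 j
    simp only [Finset.sum_const, Finset.card_univ, Fintype.card_fin, nsmul_eq_mul] at e3
    push_cast at e3
    linarith
  refine le_trans ?_ (meanDisplacement_le B φ (testToL2 f) hφ)
  rw [inv_mul_le_iff₀ (by positivity)]
  refine h3.trans (le_of_eq ?_)
  ring

end

/-! ### The operator inequality -/

theorem mainTheorem7 (μ : ℝ) (W : InteractionPotential)
    (hsup : 1 < supSpecChiInfty W μ)
    (hsimple : Module.finrank ℂ (critEigenspace W μ) = 1)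
    (φ : L2) (hφ : φ ∈ critEigenspace W μ) (hnorm : ‖φ‖ = 1)
    (B₀ : ℝ) (hB₀ : 0 < B₀) :
    ∃ c > (0 : ℝ), ∃ E₀ > (0 : ℝ), ∀ B : ℝ, 0 < B → B ≤ B₀ →
      ∃ S : L2 →L[ℂ] L2, IsMagRatio B E₀ S ∧ (c : ℂ) • S ≤ 1 - opR B φ ^ 2 := by
  obtain ⟨c, hc, h⟩ := exists_magRatio_form_le φ hnorm B₀
  -- `E₀ = 1` because the graph norm weighs `‖u‖²` and `‖Π u‖²` equally. What remains is symmetry of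
  -- the difference, and `⟨R²ψ, ψ⟩ = ‖Rψ‖²` by symmetry of `R`.
  refine ⟨c, hc, 1, one_pos, fun B hB hBB => ?_⟩
  obtain ⟨S, hS, hsymm, hle⟩ := h B (by rwa [abs_of_pos hB])
  refine ⟨S, hS, ?_⟩
  have hR : ∀ f, (opR B φ ^ 2) f = opR B φ (opR B φ f) := fun f => by rw [pow_two]; rfl
  have hT : ∀ f, (1 - opR B φ ^ 2 - (c : ℂ) • S : L2 →L[ℂ] L2) f =
      f - opR B φ (opR B φ f) - (c : ℂ) • S f :=
    fun f => by rw [← hR]; rfl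
  rw [ContinuousLinearMap.le_def]
  refine ⟨fun f g => ?_, fun ψ => ?_⟩
  · change inner ℂ ((1 - opR B φ ^ 2 - (c : ℂ) • S : L2 →L[ℂ] L2) f) g =
      inner ℂ f ((1 - opR B φ ^ 2 - (c : ℂ) • S : L2 →L[ℂ] L2) g)
    rw [hT, hT]
    simp only [inner_sub_left, inner_sub_right, inner_smul_left, inner_smul_right, inner_opR, hsymm,
      Complex.conj_ofReal]
  · change 0 ≤ (inner ℂ ((1 - opR B φ ^ 2 - (c : ℂ) • S : L2 →L[ℂ] L2) ψ) ψ).re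
    rw [hT, inner_sub_left, inner_sub_left, inner_smul_left, inner_opR, Complex.conj_ofReal,
      Complex.sub_re, Complex.sub_re, Complex.re_ofReal_mul]
    have e1 := inner_self_eq_norm_sq (𝕜 := ℂ) ψ
    have e2 := inner_self_eq_norm_sq (𝕜 := ℂ) (opR B φ ψ)
    simp only [RCLike.re_to_complex] at e1 e2
    rw [e1, e2]
    linarith [hle ψ]
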